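/- Let $D>0$, $R>0$, $a\in\mathbb{R}$ with $\frac{aR}{D}\in(0,e^{-1}]$. Let $\Phi\in L^\infty_{\mathrm{loc}}([0,\infty))$ be of at most exponential order (there are $M\ge 0$, $\gamma\in\mathbb{R}$ with $|\Phi(t)|\le Me^{\gamma t}$ for a.e. $t\ge 0$) with $\Phi(t)\ge 0$ for a.e. $t\ge 0$, and let $u_0\in H^1(\mathbb{R})$ be real-valued with $u_0\ge 0$. Consider the problem $$\partial_t u = D\,\partial_x^2 u+\Psi_t[u]\,\delta_0\quad (t>0,\ x\in\mathbb{R}),\qquad u(0,\cdot)=u_0,\qquad \Psi_t[u]:=\Phi(t)-a\bigl[u(t,-R)+u(t,R)\bigr].$$ A mild solution is a continuous map $u:[0,\infty)\to H^1(\mathbb{R})$ with $u(0)=u_0$ such that, for every $t>0$, $$u(t)=e^{tD\Delta}u_0+\int_0^t \Psi_\tau[u]\,e^{(t-\tau)D\Delta}\delta_0\,\mathrm{d}\tau ,$$ where the integral is a Bochner integral in $H^1(\mathbb{R})$, $e^{s\Delta}$ ($s>0$) is convolution with the heat kernel $\frac{1}{\sqrt{4\pi s}}e^{-x^2/(4s)}$,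 so that $e^{s\Delta}\delta_0$ is this kernel, and elements of $H^1(\mathbb{R})$ are identified with their continuous representatives. If $u_0(-x)=u_0(x)$ for all $x\in\mathbb{R}\smallsetminus(-\frac R2,\frac R2)$, then the mild solution $u$ satisfies $u(t,x)\ge 0$ for all $t\ge 0$ and all $x\in\mathbb{R}\smallsetminus(-R,R)$. -/

import Mathlib

open MeasureTheory Set Filter Topology
open scoped ENNReal ContDiff

/-- `g` is a weak (distributional) derivative of `f` on the real line. -/
def HasWeakDeriv (f g : ℝ → ℝ) : Prop :=
  ∀ φ : ℝ → ℝ, ContDiff ℝ ∞ φ → HasCompactSupport φ →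
    ∫ x, f x * deriv φ x = -∫ x, g x * φ x

/-- Test functions are in every `L^p`. -/
theorem memLp_of_test {φ : ℝ → ℝ} (h : ContDiff ℝ ∞ φ) (hc : HasCompactSupport φ) :
    MemLp φ 2 (volume : Measure ℝ) :=
  h.continuous.memLp_of_hasCompactSupport hc

theorem memLp_deriv_of_test {φ : ℝ → ℝ} (h : ContDiff ℝ ∞ φ) (hc : HasCompactSupport φ) :
    MemLp (deriv φ) 2 (volume : Measure ℝ) :=
  (h.continuous_deriv (by simp)).memLp_of_hasCompactSupport hc.deriv

theorem lp_mul_integrable {φ : ℝ → ℝ} (hφ : MemLp φ 2 (volume : Measure ℝ))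
    (f : Lp ℝ 2 (volume : Measure ℝ)) : Integrable (fun x => f x * φ x) :=
  (Lp.memLp f).integrable_mul hφ

theorem lp_inner_toLp {φ : ℝ → ℝ} (hφ : MemLp φ 2 (volume : Measure ℝ))
    (f : Lp ℝ 2 (volume : Measure ℝ)) :
    inner ℝ (hφ.toLp φ) f = ∫ x, f x * φ x := by
  rw [L2.inner_def]
  refine integral_congr_ae ?_
  filter_upwards [hφ.coeFn_toLp] with x hx
  rw [hx]
  rfl

/-- A pair of `L²` functions satisfies the weak derivative relation iff it is annihilated by all
the functionals coming from test functions. -/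
theorem hasWeakDeriv_iff (f g : Lp ℝ 2 (volume : Measure ℝ)) :
    HasWeakDeriv f g ↔ ∀ (φ : ℝ → ℝ) (h : ContDiff ℝ ∞ φ) (hc : HasCompactSupport φ),
      inner ℝ ((memLp_deriv_of_test h hc).toLp (deriv φ)) f
        + inner ℝ ((memLp_of_test h hc).toLp φ) g = 0 := by
  simp only [lp_inner_toLp, HasWeakDeriv, ← eq_neg_iff_add_eq_zero]

/-- The Sobolev space `H¹(ℝ)`, realised as the space of pairs `(f, f')` of functions in `L²(ℝ)`
where `f'` is the weak derivative of `f`.  The norm inherited from the `ℓ²`-product `L² × L²` is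
the usual one, `‖f‖² = ‖f‖²_{L²} + ‖f'‖²_{L²}`. -/
def sobolevH1 : Submodule ℝ
    (WithLp 2 (Lp ℝ 2 (volume : Measure ℝ) × Lp ℝ 2 (volume : Measure ℝ))) where
  carrier := {p | HasWeakDeriv p.fst p.snd}
  zero_mem' := by
    simp only [mem_ofPred_eq, hasWeakDeriv_iff]
    intro φ h hc
    simp
  add_mem' := by
    intro p q hp hq
    simp only [mem_ofPred_eq, hasWeakDeriv_iff] at hp hq ⊢
    intro φ h hc
    simp only [WithLp.add_fst, WithLp.add_snd, inner_add_right]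
    linarith [hp φ h hc, hq φ h hc]
  smul_mem' := by
    intro c p hp
    simp only [mem_ofPred_eq, hasWeakDeriv_iff] at hp ⊢
    intro φ h hc
    simp only [WithLp.smul_fst, WithLp.smul_snd, inner_smul_right]
    rw [← mul_add, hp φ h hc, mul_zero]

/-- The Hilbert space `H¹(ℝ)`. -/
abbrev H1 : Type := sobolevH1

theorem isClosed_sobolevH1 : IsClosed (sobolevH1 : Set
    (WithLp 2 (Lp ℝ 2 (volume : Measure ℝ) × Lp ℝ 2 (volume : Measure ℝ)))) := by
  have : (sobolevH1 : Set
      (WithLp 2 (Lp ℝ 2 (volume : Measure ℝ) × Lp ℝ 2 (volume : Measure ℝ)))) =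
      ⋂ (φ : ℝ → ℝ) (h : ContDiff ℝ ∞ φ) (hc : HasCompactSupport φ),
        {p | inner ℝ ((memLp_deriv_of_test h hc).toLp (deriv φ)) p.fst
          + inner ℝ ((memLp_of_test h hc).toLp φ) p.snd = 0} := by
    ext p
    simp only [mem_iInter, mem_ofPred_eq]
    exact hasWeakDeriv_iff p.fst p.snd
  rw [this]
  refine isClosed_iInter fun φ => isClosed_iInter fun h => isClosed_iInter fun hc => ?_
  refine isClosed_eq ?_ continuous_const
  have h1 : Continuous fun p : WithLp 2 (Lp ℝ 2 (volume : Measure ℝ) ×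
      Lp ℝ 2 (volume : Measure ℝ)) => p.fst :=
    continuous_fst.comp (WithLp.prod_continuous_ofLp 2 _ _)
  have h2 : Continuous fun p : WithLp 2 (Lp ℝ 2 (volume : Measure ℝ) ×
      Lp ℝ 2 (volume : Measure ℝ)) => p.snd :=
    continuous_snd.comp (WithLp.prod_continuous_ofLp 2 _ _)
  exact (continuous_const.inner h1).add (continuous_const.inner h2)

instance : CompleteSpace H1 := isClosed_sobolevH1.completeSpace_coe

/-- A locally integrable function with vanishing weak derivative is a.e. constant. -/
theorem ae_const_of_weakDeriv_zero {h : ℝ → ℝ} (hloc : LocallyIntegrable h)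
    (hz : ∀ φ : ℝ → ℝ, ContDiff ℝ ∞ φ → HasCompactSupport φ → ∫ x, h x * deriv φ x = 0) :
    ∃ c : ℝ, ∀ᵐ x, h x = c := by
  have hint : ∀ φ : ℝ → ℝ, ContDiff ℝ ∞ φ → HasCompactSupport φ →
      Integrable (fun x => h x * φ x) := by
    intro φ hφ hc
    have := hloc.integrable_smul_left_of_hasCompactSupport hφ.continuous hc
    simpa [mul_comm] using this
  let b : ContDiffBump (0 : ℝ) := ⟨1, 2, one_pos, one_lt_two⟩
  let ρ : ℝ → ℝ := b.normed volume
  have hρ : ContDiff ℝ ∞ ρ := b.contDiff_normed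
  have hρc : HasCompactSupport ρ := b.hasCompactSupport_normed
  have hρ1 : ∫ x, ρ x = 1 := b.integral_normed
  refine ⟨∫ x, h x * ρ x, ?_⟩
  set c := ∫ x, h x * ρ x with hcdef
  refine ae_eq_of_integral_contDiff_smul_eq hloc (locallyIntegrable_const c) ?_
  intro ψ hψ hψc
  set m := ∫ x, ψ x with hm
  let η : ℝ → ℝ := fun x => ψ x - m * ρ x
  have hη : ContDiff ℝ ∞ η := hψ.sub (contDiff_const.mul hρ)
  have hηc : HasCompactSupport η := hψc.sub hρc.mul_left
  have hηi : Integrable η := hη.continuous.integrable_of_hasCompactSupport hηc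
  have hψi : Integrable ψ := hψ.continuous.integrable_of_hasCompactSupport hψc
  have hρi : Integrable ρ := hρ.continuous.integrable_of_hasCompactSupport hρc
  have hη0 : ∫ x, η x = 0 := by
    simp only [η]
    rw [integral_sub hψi (hρi.const_mul m), integral_const_mul, hρ1, ← hm]; ring
  obtain ⟨A, hA⟩ : ∃ A : ℝ, ∀ x, A ≤ |x| → η x = 0 := by
    obtain ⟨A, hA⟩ := hηc.isCompact.isBounded.subset_closedBall (0 : ℝ)
    refine ⟨A + 1, fun x hx => ?_⟩
    by_contra hne
    have := hA (subset_tsupport _ (Function.mem_support.2 hne))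
    rw [mem_closedBall_zero_iff, Real.norm_eq_abs] at this
    linarith
  let Φ : ℝ → ℝ := fun x => ∫ y in (-A)..x, η y
  have hΦd : ∀ x, HasDerivAt Φ (η x) x := fun x =>
    hη.continuous.integral_hasStrictDerivAt _ x |>.hasDerivAt
  have hΦ' : deriv Φ = η := funext fun x => (hΦd x).deriv
  have hΦs : ContDiff ℝ ∞ Φ := by
    rw [contDiff_infty_iff_deriv, hΦ']
    exact ⟨fun x => (hΦd x).differentiableAt, hη⟩
  have hzero : ∀ x y, x ≤ y → (∀ z, z ∈ Ioc x y → η z = 0) → ∫ z in x..y, η z = 0 := by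
    intro x y hxy hz
    rw [intervalIntegral.integral_of_le hxy]
    exact setIntegral_eq_zero_of_forall_eq_zero hz
  have hΦc : HasCompactSupport Φ := by
    refine HasCompactSupport.intro (isCompact_closedBall (0 : ℝ) |A|) fun x hx => ?_
    rw [mem_closedBall_zero_iff, Real.norm_eq_abs, not_le] at hx
    rcases le_or_gt 0 x with h0 | h0
    · rw [abs_of_nonneg h0] at hx
      have h2 : ∫ y in Ioi x, η y = 0 := by
        refine setIntegral_eq_zero_of_forall_eq_zero fun y hy => hA y ?_
        have : x < y := hy
        linarith [le_abs_self A, le_abs_self y]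
      have h3 : ∫ y in Iic (-A), η y = 0 := by
        rw [integral_Iic_eq_integral_Iio]
        refine setIntegral_eq_zero_of_forall_eq_zero fun y hy => hA y ?_
        have : y < -A := hy
        linarith [neg_abs_le y]
      have h4 := intervalIntegral.integral_Iic_sub_Iic (a := -A) (b := x)
        hηi.integrableOn hηi.integrableOn
      have h5 := intervalIntegral.integral_Iic_add_Ioi (b := x)
        hηi.integrableOn hηi.integrableOn
      simp only [Φ]
      rw [← h4]
      linarith
    · rw [abs_of_neg h0] at hx
      have hxA : x ≤ -A := by linarith [le_abs_self A]
      simp only [Φ]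
      rw [intervalIntegral.integral_symm]
      rw [intervalIntegral.integral_of_le hxA, integral_Ioc_eq_integral_Ioo,
        setIntegral_eq_zero_of_forall_eq_zero, neg_zero]
      intro y hy
      refine hA y ?_
      linarith [hy.2, neg_abs_le y]
  have key := hz Φ hΦs hΦc
  rw [hΦ'] at key
  have e1 : ∫ x, h x * η x = (∫ x, h x * ψ x) - m * c := by
    have : (fun x => h x * η x) = fun x => h x * ψ x - m * (h x * ρ x) := by
      funext x; simp only [η]; ring
    rw [this, integral_sub (hint ψ hψ hψc) ((hint ρ hρ hρc).const_mul m), integral_const_mul]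
  rw [e1] at key
  have e2 : ∫ x, ψ x • c = m * c := by
    simp only [smul_eq_mul]; rw [integral_mul_const]
  rw [e2]
  simp only [smul_eq_mul, mul_comm (ψ _)]
  linarith

/-- One-dimensional Sobolev embedding: every element of `H¹(ℝ)` has a continuous
representative. -/
theorem H1.exists_continuous_rep (f : H1) :
    ∃ F : ℝ → ℝ, Continuous F ∧ (f.1.fst : ℝ → ℝ) =ᵐ[volume] F := by
  let g : ℝ → ℝ := ⇑f.1.snd
  have hgl : LocallyIntegrable g := (Lp.memLp f.1.snd).locallyIntegrable (by norm_num)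
  have hfl : LocallyIntegrable (f.1.fst : ℝ → ℝ) :=
    (Lp.memLp f.1.fst).locallyIntegrable (by norm_num)
  have hgi : ∀ a b, IntervalIntegrable g volume a b := fun a b =>
    (hgl.integrableOn_isCompact isCompact_uIcc).intervalIntegrable
  let G : ℝ → ℝ := fun x => ∫ y in (0 : ℝ)..x, g y
  have hG : Continuous G := intervalIntegral.continuous_primitive hgi 0
  have hGw : ∀ φ : ℝ → ℝ, ContDiff ℝ ∞ φ → HasCompactSupport φ →
      ∫ x, G x * deriv φ x = -∫ x, g x * φ x := by
    intro φ hφ hφc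
    obtain ⟨A, hA0, hA⟩ : ∃ A : ℝ, 0 < A ∧ ∀ x, A ≤ |x| → φ x = 0 ∧ deriv φ x = 0 := by
      obtain ⟨A, hA⟩ := hφc.isCompact.isBounded.subset_closedBall (0 : ℝ)
      refine ⟨|A| + 1, by positivity, fun x hx => ?_⟩
      have hx' : x ∉ tsupport φ := fun hmem => by
        have := hA hmem
        rw [mem_closedBall_zero_iff, Real.norm_eq_abs] at this
        linarith [le_abs_self A]
      exact ⟨image_eq_zero_of_notMem_tsupport hx', image_eq_zero_of_notMem_tsupport
        fun h => hx' (tsupport_deriv_subset h)⟩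
    have hle : -A ≤ A := by linarith
    have red : ∀ k : ℝ → ℝ, (∀ x, A ≤ |x| → k x = 0) → ∫ x, k x = ∫ x in (-A)..A, k x := by
      intro k hk
      rw [intervalIntegral.integral_of_le hle, setIntegral_eq_integral_of_forall_compl_eq_zero]
      intro x hx
      apply hk
      by_contra hlt
      rw [not_le, abs_lt] at hlt
      exact hx ⟨hlt.1, hlt.2.le⟩
    rw [red _ fun x hx => by rw [(hA x hx).2, mul_zero],
      red _ fun x hx => by rw [(hA x hx).1, mul_zero]]
    have acG : AbsolutelyContinuousOnInterval G (-A) A :=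
      (hgi (-A) A).absolutelyContinuousOnInterval_intervalIntegral
        (by rw [uIcc_of_le hle]; constructor <;> linarith)
    have acφ : AbsolutelyContinuousOnInterval φ (-A) A :=
      ((hφ.of_le (by simp)).contDiffOn).absolutelyContinuousOnInterval
    have ibp := acG.integral_mul_deriv_eq_deriv_mul acφ
    rw [ibp, (hA A (le_abs_self A)).1, (hA (-A) (by simp [le_abs_self])).1]
    have : ∫ x in (-A)..A, deriv G x * φ x = ∫ x in (-A)..A, g x * φ x := by
      refine intervalIntegral.integral_congr_ae ?_
      have := LocallyIntegrable.ae_hasDerivAt_integral hgl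
      filter_upwards [this] with x hx _
      rw [(hx 0).deriv]
    rw [this]; ring
  obtain ⟨c, hc⟩ := ae_const_of_weakDeriv_zero (h := fun x => f.1.fst x - G x)
    (hfl.sub hG.locallyIntegrable) (by
      intro φ hφ hφc
      have i1 := lp_mul_integrable (memLp_deriv_of_test hφ hφc) f.1.fst
      have i2 : Integrable fun x => G x * deriv φ x :=
        (hG.mul (hφ.continuous_deriv (by simp))).integrable_of_hasCompactSupport
          hφc.deriv.mul_left
      simp only [sub_mul]
      rw [integral_sub i1 i2, hGw φ hφ hφc]
      have := f.2 φ hφ hφc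
      rw [this, sub_self])
  refine ⟨fun x => c + G x, continuous_const.add hG, ?_⟩
  filter_upwards [hc] with x hx
  linarith

/-- The continuous representative of an element of `H¹(ℝ)` (it is unique, since two continuous
functions that agree almost everywhere are equal).  Point values `f(x)` of `f ∈ H¹(ℝ)` are the
values of this function. -/
noncomputable def H1.rep (f : H1) : ℝ → ℝ := f.exists_continuous_rep.choose

theorem H1.continuous_rep (f : H1) : Continuous f.rep := f.exists_continuous_rep.choose_spec.1

theorem H1.coeFn_ae_eq_rep (f : H1) : (f.1.fst : ℝ → ℝ) =ᵐ[volume] f.rep :=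
  f.exists_continuous_rep.choose_spec.2

/-- The heat kernel `exp(-x²/(4s)) / √(4πs)` on the line, for `s > 0`.  For `s ≤ 0` the formula
evaluates to `0`. -/
noncomputable def heatKernel (s x : ℝ) : ℝ :=
  Real.exp (-x ^ 2 / (4 * s)) / √(4 * Real.pi * s)

theorem heatKernel_of_nonpos {s : ℝ} (hs : s ≤ 0) (x : ℝ) : heatKernel s x = 0 := by
  have : √(4 * Real.pi * s) = 0 :=
    Real.sqrt_eq_zero_of_nonpos (mul_nonpos_of_nonneg_of_nonpos (by positivity) hs)
  simp [heatKernel, this]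

theorem hasDerivAt_heatKernel (s x : ℝ) :
    HasDerivAt (heatKernel s) (-(2 * x) / (4 * s) * heatKernel s x) x := by
  unfold heatKernel
  have h0 : HasDerivAt (fun y : ℝ => -y ^ 2 / (4 * s)) (-(2 * x) / (4 * s)) x := by
    simpa using ((hasDerivAt_pow 2 x).fun_neg).div_const (4 * s)
  have h := h0.exp.div_const (√(4 * Real.pi * s))
  rwa [mul_comm (Real.exp _), mul_div_assoc] at h

theorem memLp_heatKernel (s : ℝ) : MemLp (heatKernel s) 2 (volume : Measure ℝ) := by
  rcases le_or_gt s 0 with hs | hs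
  · have : heatKernel s = 0 := funext fun x => heatKernel_of_nonpos hs x
    rw [this]; exact MemLp.zero
  · have hc : Continuous (heatKernel s) :=
      continuous_iff_continuousAt.2 fun x => (hasDerivAt_heatKernel s x).continuousAt
    rw [memLp_two_iff_integrable_sq hc.aestronglyMeasurable]
    have := (integrable_exp_neg_mul_sq (b := 1 / (2 * s)) (by positivity)).const_mul
      ((√(4 * Real.pi * s))⁻¹ ^ 2)
    refine this.congr (ae_of_all _ fun x => ?_)
    simp only [heatKernel]
    have e : ((2 : ℕ) : ℝ) * (-x ^ 2 / (4 * s)) = -(1 / (2 * s)) * x ^ 2 := by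
      push_cast; field_simp; ring
    rw [div_pow, ← Real.exp_nat_mul, e, inv_pow, mul_comm]
    exact (div_eq_mul_inv _ _).symm

theorem memLp_deriv_heatKernel (s : ℝ) :
    MemLp (deriv (heatKernel s)) 2 (volume : Measure ℝ) := by
  have hd : deriv (heatKernel s) = fun x => -(2 * x) / (4 * s) * heatKernel s x :=
    funext fun x => (hasDerivAt_heatKernel s x).deriv
  rcases le_or_gt s 0 with hs | hs
  · have : deriv (heatKernel s) = 0 := by
      rw [hd]; funext x; simp [heatKernel_of_nonpos hs]
    rw [this]; exact MemLp.zero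
  · have hc : Continuous (heatKernel s) :=
      continuous_iff_continuousAt.2 fun x => (hasDerivAt_heatKernel s x).continuousAt
    have hc' : Continuous (deriv (heatKernel s)) := by
      rw [hd]; fun_prop
    rw [memLp_two_iff_integrable_sq hc'.aestronglyMeasurable]
    have := (integrable_rpow_mul_exp_neg_mul_sq (b := 1 / (2 * s)) (by positivity)
      (s := 2) (by norm_num)).const_mul (1 / (4 * s ^ 2) * (√(4 * Real.pi * s))⁻¹ ^ 2)
    refine this.congr (ae_of_all _ fun x => ?_)
    rw [hd]
    simp only [heatKernel]
    rw [mul_pow, div_pow (Real.exp _), ← Real.exp_nat_mul, inv_pow]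
    have : ((2 : ℕ) : ℝ) * (-x ^ 2 / (4 * s)) = -(1 / (2 * s)) * x ^ 2 := by
      push_cast; field_simp; ring
    rw [this, Real.rpow_ofNat]
    field_simp
    norm_num [mul_comm]

/-- The heat kernel as an element of `H¹(ℝ)`.  For `s > 0` this is `e^{sΔ} δ₀`, the
result of applying the heat semigroup to the Dirac measure at the origin. -/
noncomputable def heatKernelH1 (s : ℝ) : H1 :=
  ⟨WithLp.toLp 2 ((memLp_heatKernel s).toLp _, (memLp_deriv_heatKernel s).toLp _), by
    intro φ hφ hφc
    have e1 : ∫ x, ((memLp_heatKernel s).toLp _ : ℝ → ℝ) x * deriv φ x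
        = ∫ x, heatKernel s x * deriv φ x := by
      refine integral_congr_ae ?_
      filter_upwards [(memLp_heatKernel s).coeFn_toLp] with x hx
      rw [hx]
    have e2 : ∫ x, ((memLp_deriv_heatKernel s).toLp _ : ℝ → ℝ) x * φ x
        = ∫ x, deriv (heatKernel s) x * φ x := by
      refine integral_congr_ae ?_
      filter_upwards [(memLp_deriv_heatKernel s).coeFn_toLp] with x hx
      rw [hx]
    refine e1.trans (Eq.trans ?_ (congrArg Neg.neg e2.symm))
    refine integral_mul_deriv_eq_deriv_mul_of_integrable
      (fun x _ => (hasDerivAt_heatKernel s x).differentiableAt.hasDerivAt)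
      (fun x _ => (hφ.differentiable (by simp) x).hasDerivAt) ?_ ?_ ?_
    · exact (memLp_heatKernel s).integrable_mul (memLp_deriv_of_test hφ hφc)
    · exact (memLp_deriv_heatKernel s).integrable_mul (memLp_of_test hφ hφc)
    · exact (memLp_heatKernel s).integrable_mul (memLp_of_test hφ hφc)⟩

/-- The heat semigroup `e^{sΔ} f` for `s > 0`: convolution of `f` with the heat kernel. -/
noncomputable def heatFlow (s : ℝ) (f : ℝ → ℝ) (x : ℝ) : ℝ :=
  ∫ y, heatKernel s (x - y) * f y

/-- The intensity `Ψ_t[v] = Φ(t) - a (v(-R) + v(R))` of the point source at the origin. -/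
noncomputable def feedback (R a : ℝ) (Φ : ℝ → ℝ) (t : ℝ) (v : H1) : ℝ :=
  Φ t - a * (v.rep (-R) + v.rep R)

/-- `u` is a mild solution in `H¹(ℝ)` of
`∂ₜ u = D ∂ₓ² u + (Φ(t) - a [u(t,-R) + u(t,R)]) δ₀`, `u(0) = u₀`:
a continuous curve `[0, ∞) → H¹(ℝ)` starting at `u₀` that satisfies the variation of constants
formula `u(t) = e^{tDΔ} u₀ + ∫₀ᵗ Ψ_τ[u(τ)] e^{(t-τ)DΔ} δ₀ dτ` for all `t > 0`, where the integral
is a Bochner integral in `H¹(ℝ)`.  (Values of `u` at negative times play no role.) -/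
structure IsMildSolution (D R a : ℝ) (Φ : ℝ → ℝ) (u₀ : H1) (u : ℝ → H1) : Prop where
  continuousOn : ContinuousOn u (Ici 0)
  initial : u 0 = u₀
  integrable : ∀ t, 0 < t → IntervalIntegrable
    (fun τ => feedback R a Φ τ (u τ) • heatKernelH1 (D * (t - τ))) volume 0 t
  variation_of_constants : ∀ t, 0 < t →
    (u t).rep =ᵐ[volume] fun x => heatFlow (D * t) u₀.rep x +
      (∫ τ in (0 : ℝ)..t, feedback R a Φ τ (u τ) • heatKernelH1 (D * (t - τ))).rep x

/-- `Φ ∈ L^∞_loc([0, ∞))`: measurable and essentially bounded on every `[0, T]`. -/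
def IsLocallyBounded (Φ : ℝ → ℝ) : Prop :=
  ∀ T : ℝ, MemLp Φ ∞ (volume.restrict (Icc 0 T))

/-- `Φ` is of (at most) exponential order on `[0, ∞)`. -/
def IsExponentialOrder (Φ : ℝ → ℝ) : Prop :=
  ∃ M γ : ℝ, 0 ≤ M ∧ ∀ᵐ t ∂(volume.restrict (Ici (0 : ℝ))), |Φ t| ≤ M * Real.exp (γ * t)

/-! Fix `t` and look to the right of `R`; the left side follows by reflection. On the half-line
beyond `R`, the solution at time `t` is the Dirichlet heat flow of `u₀` plus the contribution `w(x)`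
at distance `x` from `R` of the boundary values `u(s, R)`, which enter through the first passage
density `2 * D * heatFlux (D * (t - s)) x`. The Dirichlet part is nonnegative because `|x + R - y| ≤
x + |R - y|`, so `w ≥ 0` suffices.

The first passage identity `integral_heatFlux_mul_heatKernel` turns `w` into an explicit
superposition of kernels, `w(x) = ∫ u₀(y) K(x + |R - y|) dy + ∫ Ψ(r) K(D(t - r), x + R) dr`.
Differentiating puts fluxes at distance `x + R` against `Ψ = Φ - a(u(·, R) + u(·, -R))`. The same
identity, read backwards, converts the flux against `u(·, R)` into `w(x + R)`, and the flux against
`u(·, -R)` into its analogue for reflected data. The delay in the feedback thus becomes an advance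
in space: with `c = a / D`, `w'(x) ≤ c w(x + R)` up to an asymmetry error. By the symmetry off
`(-R/2, R/2)`, that error is at most `(c / 2) ∫ₓ^{x+R} k`, where `k` is the flux of the mass on
`[-R/2, 0)`; the term `-k(x)`, already present in `w'`, pays for it.

Since `c R ≤ 1/e`, one can write `c = l exp(-l R)` with `l R ≤ 1`. With the weight `exp(-l x)` the
inequality says that `exp(-l x) w(x) - l ∫ₓ^{x+R} exp(-l y) w(y) dy`, less a nonnegative corrector
built from `k`, is nonincreasing; it tends to `0` at infinity, hence is nonnegative. So `w`
dominates its forward averages of total mass `1 - exp(-l R) < 1`, and a function bounded below with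
this property has nonnegative infimum (`nonneg_of_advanced_deriv_le`,
`nonneg_of_forward_average_le`). -/

/-! ### Pointwise bounds for the heat kernel and its flux. -/

/-- The negative spatial derivative `x / (2 s) * heatKernel s x` of the heat kernel. -/
noncomputable def heatFlux (s x : ℝ) : ℝ := x / (2 * s) * heatKernel s x

theorem heatKernel_nonneg (s x : ℝ) : 0 ≤ heatKernel s x := by
  unfold heatKernel; positivity

theorem heatKernel_neg (s x : ℝ) : heatKernel s (-x) = heatKernel s x := by
  simp [heatKernel]

theorem heatKernel_abs (s x : ℝ) : heatKernel s |x| = heatKernel s x := by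
  simp [heatKernel]

theorem heatKernel_le_of_le {s x y : ℝ} (hx : 0 ≤ x) (hxy : x ≤ y) :
    heatKernel s y ≤ heatKernel s x := by
  rcases le_or_gt s 0 with hs | hs
  · simp [heatKernel_of_nonpos hs]
  · unfold heatKernel
    gcongr

theorem measurable_heatKernel : Measurable fun p : ℝ × ℝ => heatKernel p.1 p.2 := by
  unfold heatKernel; fun_prop

theorem measurable_heatFlux : Measurable fun p : ℝ × ℝ => heatFlux p.1 p.2 := by
  unfold heatFlux
  exact (measurable_snd.div (measurable_fst.const_mul 2)).mul measurable_heatKernel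

theorem continuous_heatKernel (s : ℝ) : Continuous (heatKernel s) :=
  continuous_iff_continuousAt.2 fun x => (hasDerivAt_heatKernel s x).continuousAt

theorem continuous_heatFlux (s : ℝ) : Continuous (heatFlux s) :=
  (continuous_id.div_const _).mul (continuous_heatKernel s)

theorem heatFlux_nonneg {s x : ℝ} (hx : 0 ≤ x) : 0 ≤ heatFlux s x := by
  rcases le_or_gt s 0 with hs | hs
  · simp [heatFlux, heatKernel_of_nonpos hs]
  · exact mul_nonneg (by positivity) (heatKernel_nonneg s x)

theorem heatFlux_of_nonpos {s : ℝ} (hs : s ≤ 0) (x : ℝ) : heatFlux s x = 0 := by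
  simp [heatFlux, heatKernel_of_nonpos hs]

theorem hasDerivAt_heatKernel_heatFlux (s x : ℝ) :
    HasDerivAt (heatKernel s) (-heatFlux s x) x := by
  convert hasDerivAt_heatKernel s x using 1
  unfold heatFlux
  rw [← neg_mul]
  congr 1
  rcases eq_or_ne s 0 with rfl | h
  · simp
  · field_simp; norm_num

theorem le_four_pi_mul {s : ℝ} (hs : 0 < s) : s ≤ 4 * Real.pi * s := by
  nlinarith [Real.pi_gt_three]

/-- Away from the spatial origin the heat kernel is bounded on bounded time intervals. -/
theorem heatKernel_le {r s T x : ℝ} (hr : 0 < r) (hx : r ≤ x) (hs : s ≤ T) :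
    heatKernel s x ≤ 4 * √T / r ^ 2 := by
  rcases le_or_gt s 0 with hs0 | hs0
  · rw [heatKernel_of_nonpos hs0]; positivity
  have hv : 0 < r ^ 2 / (4 * s) := by positivity
  -- This is `exp(-v) ≤ 1 / v` with `v = r² / (4 s)`; the gained factor `s` beats the singular `1 /
  -- √s`.
  have h1 : Real.exp (-r ^ 2 / (4 * s)) ≤ 4 * s / r ^ 2 := by
    rw [neg_div, Real.exp_neg, show 4 * s / r ^ 2 = (r ^ 2 / (4 * s))⁻¹ by rw [inv_div]]
    exact inv_anti₀ hv ((le_add_of_nonneg_right zero_le_one).trans (Real.add_one_le_exp _))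
  calc heatKernel s x ≤ heatKernel s r := heatKernel_le_of_le hr.le hx
    _ ≤ (4 * s / r ^ 2) / √s := by
        unfold heatKernel
        gcongr
        exact le_four_pi_mul hs0
    _ = 4 * (s / √s) / r ^ 2 := by ring
    _ = 4 * √s / r ^ 2 := by rw [Real.div_sqrt]
    _ ≤ 4 * √T / r ^ 2 := by gcongr

/-- The flux is more singular in time than the kernel, so the second-order bound `exp(-v) ≤ 2 / v²`
is needed. -/
theorem heatFlux_le {r s T x : ℝ} (hr : 0 < r) (hx : r ≤ x) (hs : s ≤ T) :
    heatFlux s x ≤ 16 * √T / r ^ 3 := by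
  have hx0 : 0 < x := hr.trans_le hx
  rcases le_or_gt s 0 with hs0 | hs0
  · rw [heatFlux_of_nonpos hs0]; positivity
  have hv : 0 < x ^ 2 / (4 * s) := by positivity
  have h1 : Real.exp (-x ^ 2 / (4 * s)) ≤ 32 * s ^ 2 / x ^ 4 := by
    rw [neg_div, Real.exp_neg,
      show 32 * s ^ 2 / x ^ 4 = ((x ^ 2 / (4 * s)) ^ 2 / 2)⁻¹ by field_simp; norm_num]
    refine inv_anti₀ (by positivity) ?_
    linarith [Real.quadratic_le_exp_of_nonneg hv.le]
  calc heatFlux s x ≤ x / (2 * s) * ((32 * s ^ 2 / x ^ 4) / √s) := by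
        unfold heatFlux heatKernel
        gcongr
        exact le_four_pi_mul hs0
    _ = 16 * (s / √s) / x ^ 3 := by field_simp; norm_num
    _ = 16 * √s / x ^ 3 := by rw [Real.div_sqrt]
    _ ≤ 16 * √T / r ^ 3 := by gcongr

theorem heatKernel_two_mul {s : ℝ} (z : ℝ) :
    √2 * heatKernel (2 * s) z = Real.exp (-z ^ 2 / (8 * s)) / √(4 * Real.pi * s) := by
  unfold heatKernel
  rw [show 4 * Real.pi * (2 * s) = 2 * (4 * Real.pi * s) by ring, Real.sqrt_mul zero_le_two,
    show 4 * (2 * s) = 8 * s by ring]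
  field_simp

/-- Half of the Gaussian exponent absorbs the linear factor `z`; the other half is a kernel at time
`2 s`. This provides a square integrable majorant for differentiating under the space integral. -/
theorem heatFlux_le_heatKernel_two_mul {s : ℝ} (hs : 0 < s) (z : ℝ) :
    heatFlux s z ≤ (1 + 8 * s) / (2 * s) * √2 * heatKernel (2 * s) z := by
  rw [mul_assoc, heatKernel_two_mul]
  unfold heatFlux heatKernel
  have h1 : Real.exp (-z ^ 2 / (4 * s)) =
      Real.exp (-z ^ 2 / (8 * s)) * Real.exp (-z ^ 2 / (8 * s)) := by
    rw [← Real.exp_add]; congr 1; field_simp; ring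
  have h2 : z * Real.exp (-z ^ 2 / (8 * s)) ≤ 1 + 8 * s := by
    rw [neg_div, Real.exp_neg, ← div_eq_mul_inv, div_le_iff₀ (Real.exp_pos _)]
    have h3 := Real.add_one_le_exp (z ^ 2 / (8 * s))
    have h4 : (1 + 8 * s) * (z ^ 2 / (8 * s) + 1) = z ^ 2 / (8 * s) + z ^ 2 + 1 + 8 * s := by
      field_simp; ring
    have h5 : 0 ≤ z ^ 2 / (8 * s) := by positivity
    have h6 : (1 + 8 * s) * (z ^ 2 / (8 * s) + 1) ≤ (1 + 8 * s) * Real.exp (z ^ 2 / (8 * s)) := by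
      gcongr
    nlinarith [sq_nonneg (z - 1)]
  have h7 : 0 ≤ Real.exp (-z ^ 2 / (8 * s)) / √(4 * Real.pi * s) / (2 * s) := by positivity
  rw [h1]
  calc _ = z * Real.exp (-z ^ 2 / (8 * s)) *
        (Real.exp (-z ^ 2 / (8 * s)) / √(4 * Real.pi * s) / (2 * s)) := by ring
    _ ≤ (1 + 8 * s) * (Real.exp (-z ^ 2 / (8 * s)) / √(4 * Real.pi * s) / (2 * s)) := by gcongr
    _ = _ := by ring

/-- A unit shift costs at most half the exponent and a constant, as `w² ≤ 2 z² + 2`. This gives a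
majorant uniform over a unit ball of base points. -/
theorem heatKernel_le_shift {s z w : ℝ} (hs : 0 < s) (hzw : |z - w| ≤ 1) :
    heatKernel s z ≤ Real.exp (1 / (4 * s)) * √2 * heatKernel (2 * s) w := by
  rw [mul_assoc, heatKernel_two_mul]
  unfold heatKernel
  rw [← mul_div_assoc, ← Real.exp_add]
  gcongr
  have h : w ^ 2 ≤ 2 * z ^ 2 + 2 := by
    have := (sq_le_one_iff_abs_le_one _).2 hzw
    nlinarith [sq_nonneg (2 * z - w)]
  have : 1 / (4 * s) + -w ^ 2 / (8 * s) - -z ^ 2 / (4 * s) = (2 * z ^ 2 + 2 - w ^ 2) / (8 * s) := by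
    field_simp; ring
  have h2 : 0 ≤ (2 * z ^ 2 + 2 - w ^ 2) / (8 * s) := div_nonneg (by linarith) (by positivity)
  linarith

/-! ### The first passage identity. -/

theorem tendsto_gaussian_primitive_atTop {b : ℝ} (hb : 0 < b) :
    Tendsto (fun v : ℝ => ∫ s in (0 : ℝ)..v, Real.exp (-b * s ^ 2)) atTop
      (𝓝 (√(Real.pi / b) / 2)) := by
  rw [← integral_gaussian_Ioi]
  exact intervalIntegral_tendsto_integral_Ioi 0 (integrable_exp_neg_mul_sq hb).integrableOn
    tendsto_id

theorem tendsto_gaussian_primitive_atBot {b : ℝ} (hb : 0 < b) :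
    Tendsto (fun v : ℝ => ∫ s in (0 : ℝ)..v, Real.exp (-b * s ^ 2)) atBot
      (𝓝 (-(√(Real.pi / b) / 2))) := by
  have h := ((tendsto_gaussian_primitive_atTop hb).comp tendsto_neg_atBot_atTop).neg
  refine h.congr fun v => ?_
  have := intervalIntegral.integral_comp_neg (a := 0) (b := v) fun s => Real.exp (-b * s ^ 2)
  simp only [Function.comp, neg_zero, neg_sq] at this ⊢
  rw [this, intervalIntegral.integral_symm, neg_neg]

theorem hasDerivAt_sqrt_div_sqrt {T s : ℝ} (hs : s ∈ Ioo 0 T) :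
    HasDerivAt (fun s => √s / √(T - s)) (T / (2 * √s * √(T - s) ^ 3)) s := by
  have h0 : 0 < s := hs.1
  have h1 : 0 < T - s := sub_pos.2 hs.2
  have e0 := Real.sq_sqrt h0.le
  have e1 := Real.sq_sqrt h1.le
  have p0 := Real.sqrt_pos.2 h0
  have p1 := Real.sqrt_pos.2 h1
  have d1 : HasDerivAt (fun s => √(T - s)) (-1 / (2 * √(T - s))) s :=
    ((hasDerivAt_id s).const_sub T).sqrt h1.ne'
  refine ((hasDerivAt_id s).sqrt h0.ne' |>.div d1 p1.ne').congr_deriv ?_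
  simp only [id]
  generalize √s = a at *
  generalize √(T - s) = b at *
  field_simp
  linarith

theorem tendsto_sqrt_div_sqrt_left {T : ℝ} (hT : 0 < T) :
    Tendsto (fun s => √s / √(T - s)) (𝓝[>] 0) (𝓝[>] 0) := by
  refine tendsto_nhdsWithin_iff.2 ⟨?_, ?_⟩
  · have : ContinuousAt (fun s => √s / √(T - s)) 0 :=
      Real.continuous_sqrt.continuousAt.div (by fun_prop) (by simpa using (Real.sqrt_pos.2 hT).ne')
    simpa [ContinuousAt] using this.tendsto.mono_left nhdsWithin_le_nhds
  · filter_upwards [Ioo_mem_nhdsGT hT] with s hs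
    exact div_pos (Real.sqrt_pos.2 hs.1) (Real.sqrt_pos.2 (sub_pos.2 hs.2))

theorem tendsto_sqrt_div_sqrt_right {T : ℝ} (hT : 0 < T) :
    Tendsto (fun s => √s / √(T - s)) (𝓝[<] T) atTop := by
  have h1 : Tendsto (fun s => √s) (𝓝[<] T) (𝓝 √T) :=
    Real.continuous_sqrt.continuousAt.tendsto.mono_left nhdsWithin_le_nhds
  have h2 : Tendsto (fun s => √(T - s)) (𝓝[<] T) (𝓝[>] 0) := by
    refine tendsto_nhdsWithin_iff.2 ⟨?_, ?_⟩
    · have : ContinuousAt (fun s => √(T - s)) T := by fun_prop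
      simpa [ContinuousAt] using this.tendsto.mono_left nhdsWithin_le_nhds
    · filter_upwards [self_mem_nhdsWithin] with s hs
      exact Real.sqrt_pos.2 (sub_pos.2 hs)
  simpa only [div_eq_mul_inv, Function.comp_def] using
    h1.pos_mul_atTop (Real.sqrt_pos.2 hT) (tendsto_inv_nhdsGT_zero.comp h2)

theorem intervalIntegrable_heatFlux_mul_heatKernel {T x y : ℝ} (hx : 0 < x) (hy : 0 < y)
    (a b : ℝ) : IntervalIntegrable (fun s => heatFlux (T - s) x * heatKernel s y) volume a b := by
  rw [intervalIntegrable_iff]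
  have hm : Measurable fun s => heatFlux (T - s) x * heatKernel s y :=
    (measurable_heatFlux.comp (by fun_prop : Measurable fun s : ℝ => (T - s, x))).mul
      (measurable_heatKernel.comp (by fun_prop : Measurable fun s : ℝ => (s, y)))
  refine IntegrableOn.of_bound (by simp) hm.aestronglyMeasurable
    ((16 * √(T - min a b) / x ^ 3) * (4 * √(max a b) / y ^ 2)) ?_
  refine (ae_restrict_iff' measurableSet_uIoc).2 (ae_of_all _ fun s hs => ?_)
  have hs' := uIoc_subset_uIcc hs
  rw [Real.norm_of_nonneg (mul_nonneg (heatFlux_nonneg hx.le) (heatKernel_nonneg _ _))]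
  exact mul_le_mul (heatFlux_le hx le_rfl (by linarith [hs'.1]))
    (heatKernel_le hy le_rfl hs'.2) (heatKernel_nonneg _ _) (by positivity)

/-- First passage identity: the heat kernel at distance `x + y` is obtained from the one at
distance `y` by convolution in time with the first passage density `2 * heatFlux · x`. -/
theorem integral_heatFlux_mul_heatKernel {T x y : ℝ} (hT : 0 < T) (hx : 0 < x) (hy : 0 < y) :
    ∫ s in (0 : ℝ)..T, 2 * (heatFlux (T - s) x * heatKernel s y) = heatKernel T (x + y) := by
  set b := 1 / (4 * T) with hb
  have hb0 : 0 < b := by positivity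
  set r : ℝ → ℝ := fun s => √s / √(T - s) with hr
  set E : ℝ → ℝ := fun v => ∫ s in (0 : ℝ)..v, Real.exp (-b * s ^ 2) with hEdef
  have hE : ∀ v, HasDerivAt E (Real.exp (-b * v ^ 2)) v := fun v =>
    ((by fun_prop : Continuous fun s : ℝ => Real.exp (-b * s ^ 2)).integral_hasStrictDerivAt
      0 v).hasDerivAt
  -- An explicit primitive. With `r = √(s / (T - s))`, both `(x + y)² + (x r - y / r)²` and `(x -
  -- y)² + (x r + y / r)²` equal `T (x² / (T - s) + y² / s)`, so both terms carry the same Gaussian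
  -- product; in their sum the derivatives of `y / r` cancel and only `2 x r'` remains.
  set F : ℝ → ℝ := fun s => (1 / (4 * Real.pi * T)) *
    (Real.exp (-b * (x + y) ^ 2) * E (x * r s - y * (r s)⁻¹)
      + Real.exp (-b * (x - y) ^ 2) * E (x * r s + y * (r s)⁻¹)) with hF
  have hFd : ∀ s ∈ Ioo 0 T, HasDerivAt F (2 * (heatFlux (T - s) x * heatKernel s y)) s := by
    intro s hs
    have h0 : 0 < s := hs.1
    have h1 : 0 < T - s := sub_pos.2 hs.2
    have p0 := Real.sqrt_pos.2 h0
    have p1 := Real.sqrt_pos.2 h1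
    have hrs : 0 < r s := div_pos p0 p1
    have dr := hasDerivAt_sqrt_div_sqrt hs
    have dri := dr.inv hrs.ne'
    set r' := T / (2 * √s * √(T - s) ^ 3) with hr'
    have dα : HasDerivAt (fun s => x * r s - y * (r s)⁻¹) (x * r' - y * (-r' / r s ^ 2)) s :=
      (dr.const_mul x).sub (dri.const_mul y)
    have dβ : HasDerivAt (fun s => x * r s + y * (r s)⁻¹) (x * r' + y * (-r' / r s ^ 2)) s :=
      (dr.const_mul x).add (dri.const_mul y)
    have dF := ((((hE _).comp s dα).const_mul (Real.exp (-b * (x + y) ^ 2))).add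
      (((hE _).comp s dβ).const_mul (Real.exp (-b * (x - y) ^ 2)))).const_mul
        (1 / (4 * Real.pi * T))
    refine dF.congr_deriv ?_
    have hrr : r s ^ 2 = s / (T - s) := by
      simp only [hr]; rw [div_pow, Real.sq_sqrt h0.le, Real.sq_sqrt h1.le]
    have hrr' : ((r s)⁻¹) ^ 2 = (T - s) / s := by rw [inv_pow, hrr, inv_div]
    have hri : r s * (r s)⁻¹ = 1 := mul_inv_cancel₀ hrs.ne'
    have hsum : x ^ 2 * (s / (T - s)) + y ^ 2 * ((T - s) / s) + x ^ 2 + y ^ 2 =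
        T * (x ^ 2 / (T - s) + y ^ 2 / s) := by
      field_simp; ring
    have e1 : Real.exp (-b * (x + y) ^ 2) * Real.exp (-b * (x * r s - y * (r s)⁻¹) ^ 2) =
        Real.exp (-x ^ 2 / (4 * (T - s))) * Real.exp (-y ^ 2 / (4 * s)) := by
      rw [← Real.exp_add, ← Real.exp_add]
      congr 1
      have : (x + y) ^ 2 + (x * r s - y * (r s)⁻¹) ^ 2 = T * (x ^ 2 / (T - s) + y ^ 2 / s) := by
        rw [← hsum, ← hrr, ← hrr']; linear_combination (-2 * x * y) * hri
      rw [← mul_add, this, hb]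
      field_simp
      ring
    have e2 : Real.exp (-b * (x - y) ^ 2) * Real.exp (-b * (x * r s + y * (r s)⁻¹) ^ 2) =
        Real.exp (-x ^ 2 / (4 * (T - s))) * Real.exp (-y ^ 2 / (4 * s)) := by
      rw [← Real.exp_add, ← Real.exp_add]
      congr 1
      have : (x - y) ^ 2 + (x * r s + y * (r s)⁻¹) ^ 2 = T * (x ^ 2 / (T - s) + y ^ 2 / s) := by
        rw [← hsum, ← hrr, ← hrr']; linear_combination (2 * x * y) * hri
      rw [← mul_add, this, hb]
      field_simp
      ring
    have e3 : √(4 * Real.pi * (T - s)) * √(4 * Real.pi * s) = 4 * Real.pi * (√(T - s) * √s) := by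
      rw [Real.sqrt_mul (by positivity : 0 ≤ 4 * Real.pi) (T - s),
        Real.sqrt_mul (by positivity : 0 ≤ 4 * Real.pi) s]
      linear_combination (√(T - s) * √s) * Real.mul_self_sqrt (by positivity : 0 ≤ 4 * Real.pi)
    have e4 : 2 * (heatFlux (T - s) x * heatKernel s y) =
        x / (T - s) * (Real.exp (-x ^ 2 / (4 * (T - s))) * Real.exp (-y ^ 2 / (4 * s))) /
          (4 * Real.pi * (√(T - s) * √s)) := by
      rw [← e3]; unfold heatFlux heatKernel; field_simp
    rw [e4, ← mul_assoc (Real.exp (-b * (x + y) ^ 2)), ← mul_assoc (Real.exp (-b * (x - y) ^ 2)),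
      e1, e2, ← mul_add,
      show x * r' - y * (-r' / r s ^ 2) + (x * r' + y * (-r' / r s ^ 2)) = 2 * x * r' by ring, hr']
    have e5 := Real.sq_sqrt h1.le
    generalize Real.exp (-x ^ 2 / (4 * (T - s))) * Real.exp (-y ^ 2 / (4 * s)) = m
    rw [← e5, Real.sqrt_sq p1.le]
    field_simp
  have hrl := tendsto_sqrt_div_sqrt_left hT
  have hrR := tendsto_sqrt_div_sqrt_right hT
  have hrl0 : Tendsto (fun s => x * r s) (𝓝[>] 0) (𝓝 0) := by
    simpa using (hrl.mono_right nhdsWithin_le_nhds).const_mul x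
  have hrli : Tendsto (fun s => y * (r s)⁻¹) (𝓝[>] 0) atTop :=
    (tendsto_inv_nhdsGT_zero.comp hrl).const_mul_atTop hy
  have hrR1 : Tendsto (fun s => x * r s) (𝓝[<] T) atTop := hrR.const_mul_atTop hx
  have hrRi : Tendsto (fun s => y * (r s)⁻¹) (𝓝[<] T) (𝓝 0) := by
    simpa only [mul_zero, Function.comp_def] using
      (tendsto_inv_atTop_zero.comp hrR).const_mul y
  -- The argument `x r - y / r` sweeps the whole line, contributing a full Gaussian integral,
  -- whereas `x r + y / r` tends to `+∞` at both ends and has no net contribution.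
  have hlα : Tendsto (fun s => x * r s - y * (r s)⁻¹) (𝓝[>] 0) atBot := by
    simpa only [sub_eq_add_neg, Function.comp_def] using
      hrl0.add_atBot (tendsto_neg_atTop_atBot.comp hrli)
  have hlβ : Tendsto (fun s => x * r s + y * (r s)⁻¹) (𝓝[>] 0) atTop := hrl0.add_atTop hrli
  have hRα : Tendsto (fun s => x * r s - y * (r s)⁻¹) (𝓝[<] T) atTop := by
    simpa only [sub_eq_add_neg] using hrR1.atTop_add hrRi.neg
  have hRβ : Tendsto (fun s => x * r s + y * (r s)⁻¹) (𝓝[<] T) atTop := hrR1.atTop_add hrRi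
  have hEt := tendsto_gaussian_primitive_atTop hb0
  have hEb := tendsto_gaussian_primitive_atBot hb0
  have hFl := (((hEb.comp hlα).const_mul (Real.exp (-b * (x + y) ^ 2))).add
    ((hEt.comp hlβ).const_mul (Real.exp (-b * (x - y) ^ 2)))).const_mul (1 / (4 * Real.pi * T))
  have hFr := (((hEt.comp hRα).const_mul (Real.exp (-b * (x + y) ^ 2))).add
    ((hEt.comp hRβ).const_mul (Real.exp (-b * (x - y) ^ 2)))).const_mul (1 / (4 * Real.pi * T))
  rw [intervalIntegral.integral_eq_sub_of_hasDerivAt_of_tendsto hT hFd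
    ((intervalIntegrable_heatFlux_mul_heatKernel hx hy 0 T).const_mul 2) hFl hFr]
  have e5 : √(Real.pi / b) = √(4 * Real.pi * T) := by
    rw [hb]; congr 1; field_simp
  have e6 : Real.exp (-b * (x + y) ^ 2) = Real.exp (-(x + y) ^ 2 / (4 * T)) := by
    rw [hb]; congr 1; field_simp
  rw [e5, e6]
  unfold heatKernel
  have hp : 0 < 4 * Real.pi * T := by positivity
  rw [eq_div_iff (Real.sqrt_pos.2 hp).ne']
  have := Real.mul_self_sqrt hp.le
  field_simp
  rw [Real.sq_sqrt hp.le]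
  ring

/-! ### Positivity for an advanced differential inequality. -/

theorem exists_hasDerivAt_of_continuousOn_Ioi {p : ℝ → ℝ} (hp : ContinuousOn p (Ioi 0)) :
    ∃ V : ℝ → ℝ, ∀ x, 0 < x → HasDerivAt V (p x) x := by
  refine ⟨fun x => ∫ y in (1 : ℝ)..x, p y, fun x hx => ?_⟩
  have hsub : uIcc 1 x ⊆ Ioi (0 : ℝ) := fun y hy => by
    rcases le_total 1 x with h | h
    · rw [uIcc_of_le h] at hy; exact lt_of_lt_of_le one_pos hy.1
    · rw [uIcc_of_ge h] at hy; exact lt_of_lt_of_le hx hy.1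
  exact intervalIntegral.integral_hasDerivAt_right (hp.mono hsub).intervalIntegrable
    (hp.stronglyMeasurableAtFilter isOpen_Ioi x hx) (hp.continuousAt (Ioi_mem_nhds hx))

theorem antitoneOn_Ioi_of_hasDerivAt {f f' : ℝ → ℝ} (hf : ∀ x, 0 < x → HasDerivAt f (f' x) x)
    (hf' : ∀ x, 0 < x → f' x ≤ 0) : AntitoneOn f (Ioi 0) := by
  refine antitoneOn_of_deriv_nonpos (convex_Ioi 0)
    (fun x hx => (hf x hx).continuousAt.continuousWithinAt) ?_ ?_ <;> rw [interior_Ioi]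
  · exact fun x hx => (hf x hx).differentiableAt.differentiableWithinAt
  · intro x hx
    rw [(hf x hx).deriv]
    exact hf' x hx

/-- If `f` dominates its exponentially weighted forward averages over windows of length `R`,
which have total mass less than one, then `f` is nonnegative as soon as it is bounded below. -/
theorem nonneg_of_forward_average_le {f V : ℝ → ℝ} {R l C : ℝ} (hR : 0 < R) (hl : 0 < l)
    (hC : ∀ x, 0 < x → -C ≤ f x)
    (hV : ∀ x, 0 < x → HasDerivAt V (Real.exp (-l * x) * f x) x)
    (h : ∀ x, 0 < x → l * (V (x + R) - V x) ≤ Real.exp (-l * x) * f x) :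
    ∀ x, 0 < x → 0 ≤ f x := by
  set S := f '' Ioi 0
  have hne : S.Nonempty := ⟨f 1, 1, mem_Ioi.2 one_pos, rfl⟩
  have hbdd : BddBelow S := ⟨-C, by rintro _ ⟨x, hx, rfl⟩; exact hC x hx⟩
  set i := sInf S
  have hi : ∀ x, 0 < x → i ≤ f x := fun x hx => csInf_le hbdd ⟨x, hx, rfl⟩
  set θ := 1 - Real.exp (-l * R)
  -- Replacing `f` by its infimum `i` in the average leaves the mass `θ = 1 - exp(-l R)` of the
  -- window. Taking the infimum over `x` gives `θ i ≤ i`, and `θ < 1` forces `i ≥ 0`.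
  have key : ∀ x, 0 < x → θ * i ≤ f x := by
    intro x hx
    have hE : ∀ y, HasDerivAt (fun y => -(i / l) * Real.exp (-l * y)) (Real.exp (-l * y) * i) y := by
      intro y
      have := (((hasDerivAt_id y).const_mul (-l)).exp).const_mul (-(i / l))
      refine this.congr_deriv ?_
      simp only [id]
      field_simp
    have hanti : AntitoneOn (fun y => -(i / l) * Real.exp (-l * y) - V y) (Ioi 0) :=
      antitoneOn_Ioi_of_hasDerivAt (fun y hy => (hE y).sub (hV y hy)) fun y hy => by
        rw [← mul_sub]
        exact mul_nonpos_of_nonneg_of_nonpos (Real.exp_pos _).le (by linarith [hi y hy])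
    have h1 := hanti (mem_Ioi.2 hx) (mem_Ioi.2 (by linarith : 0 < x + R)) (by linarith : x ≤ x + R)
    have h2 := h x hx
    have h3 : Real.exp (-l * (x + R)) = Real.exp (-l * x) * Real.exp (-l * R) := by
      rw [← Real.exp_add]; ring_nf
    simp only [h3] at h1
    have h4 : Real.exp (-l * x) * (θ * i) ≤ l * (V (x + R) - V x) := by
      have : Real.exp (-l * x) * (θ * i) = l * (-(i / l) * (Real.exp (-l * x) * Real.exp (-l * R))
          - -(i / l) * Real.exp (-l * x)) := by
        simp only [θ]; field_simp; ring
      rw [this]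
      exact mul_le_mul_of_nonneg_left (by linarith) hl.le
    exact le_of_mul_le_mul_left (h4.trans h2) (Real.exp_pos _)
  have h5 : θ * i ≤ i := le_csInf hne (by rintro _ ⟨x, hx, rfl⟩; exact key x hx)
  have h6 : 0 ≤ i := by
    have : 0 < Real.exp (-l * R) := Real.exp_pos _
    simp only [θ] at h5
    nlinarith
  exact fun x hx => h6.trans (hi x hx)

/-- A positivity principle for the advanced differential inequality
`f'(x) ≤ c f(x + R) - k(x) + (c / 2) ∫ₓ^{x + R} k`, where `-H` is a primitive of `k ≥ 0`. -/
theorem nonneg_of_advanced_deriv_le {f f' k H : ℝ → ℝ} {R l c C : ℝ} (hR : 0 < R) (hl : 0 < l)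
    (hlR : l * R ≤ 1) (hc : c = l * Real.exp (-l * R))
    (hf : ∀ x, 0 < x → HasDerivAt f (f' x) x) (hfC : ∀ x, 0 < x → |f x| ≤ C)
    (hH : ∀ x, 0 < x → HasDerivAt H (-k x) x) (hk : ContinuousOn k (Ioi 0))
    (hk0 : ∀ x, 0 < x → 0 ≤ k x) (hkC : ∀ x, 0 < x → k x ≤ C)
    (h : ∀ x, 0 < x → f' x ≤ c * f (x + R) - k x + c / 2 * (H x - H (x + R))) :
    ∀ x, 0 < x → 0 ≤ f x := by
  have hexp : Continuous fun x : ℝ => Real.exp (-l * x) := by fun_prop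
  have hfc : ContinuousOn f (Ioi 0) := fun x hx => (hf x hx).continuousAt.continuousWithinAt
  obtain ⟨V, hV⟩ := exists_hasDerivAt_of_continuousOn_Ioi
    (p := fun x => Real.exp (-l * x) * f x) (hexp.continuousOn.mul hfc)
  obtain ⟨K, hK⟩ := exists_hasDerivAt_of_continuousOn_Ioi
    (p := fun x => Real.exp (-l * x) * k x) (hexp.continuousOn.mul hk)
  obtain ⟨L, hL⟩ := exists_hasDerivAt_of_continuousOn_Ioi
    (p := fun x => x * (Real.exp (-l * x) * k x)) (continuousOn_id.mul (hexp.continuousOn.mul hk))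
  have hC0 : 0 ≤ C := (abs_nonneg _).trans (hfC 1 one_pos)
  have hE : ∀ x, HasDerivAt (fun x => Real.exp (-l * x)) (Real.exp (-l * x) * -l) x := fun x => by
    simpa using ((hasDerivAt_id x).const_mul (-l)).exp
  have hexpR : ∀ x, Real.exp (-l * (x + R)) = Real.exp (-l * x) * Real.exp (-l * R) := fun x => by
    rw [← Real.exp_add]; ring_nf
  have hshift : ∀ {g g' : ℝ → ℝ}, (∀ x, 0 < x → HasDerivAt g (g' x) x) →
      ∀ x, 0 < x → HasDerivAt (fun x => g (x + R)) (g' (x + R)) x := fun hg x hx =>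
    (hg (x + R) (by linarith)).comp_add_const x R
  -- the corrector `N`, equal to `∫ₓ^{x+R} exp (-l y) (1 - l (y - x) / 2) k y dy`
  set N : ℝ → ℝ := fun x => (1 + l / 2 * x) * (K (x + R) - K x) - l / 2 * (L (x + R) - L x) with hN
  have hN0 : ∀ x, 0 < x → 0 ≤ N x ∧ N x ≤ R * Real.exp (-l * x) * C := by
    intro x hx
    have hM : ∀ y, 0 < y → HasDerivAt (fun y => (1 + l / 2 * x) * K y - l / 2 * L y)
        ((1 - l / 2 * (y - x)) * (Real.exp (-l * y) * k y)) y := fun y hy => by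
      refine (((hK y hy).const_mul (1 + l / 2 * x)).sub
        ((hL y hy).const_mul (l / 2))).congr_deriv ?_
      ring
    have hconv : Convex ℝ (Icc x (x + R)) := convex_Icc _ _
    have hpos : ∀ y ∈ Icc x (x + R), 0 < y := fun y hy => hx.trans_le hy.1
    have hmem : x ∈ Icc x (x + R) := ⟨le_rfl, by linarith⟩
    have hmem' : x + R ∈ Icc x (x + R) := ⟨by linarith, le_rfl⟩
    -- Here `l R ≤ 1` keeps the weight in the corrector nonnegative on the window.
    have hw : ∀ y ∈ Icc x (x + R), 0 ≤ 1 - l / 2 * (y - x) ∧ 1 - l / 2 * (y - x) ≤ 1 := by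
      intro y hy
      have h1 : 0 ≤ l * (y - x) := mul_nonneg hl.le (by linarith [hy.1])
      have h2 : l * (y - x) ≤ l * R := by gcongr; linarith [hy.2]
      constructor <;> linarith
    constructor
    · have hmono : MonotoneOn (fun y => (1 + l / 2 * x) * K y - l / 2 * L y) (Icc x (x + R)) := by
        refine monotoneOn_of_deriv_nonneg hconv
          (fun y hy => (hM y (hpos y hy)).continuousAt.continuousWithinAt)
          (fun y hy => (hM y (hpos y (interior_subset hy))).differentiableAt.differentiableWithinAt)
          fun y hy => ?_
        have hy := interior_subset hy
        rw [(hM y (hpos y hy)).deriv]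
        exact mul_nonneg (hw y hy).1 (mul_nonneg (Real.exp_pos _).le (hk0 y (hpos y hy)))
      have := hmono hmem hmem' (by linarith)
      simp only [hN]
      simp only at this
      linarith
    · have hM2 : ∀ y, 0 < y → HasDerivAt (fun y => Real.exp (-l * x) * C * y -
          ((1 + l / 2 * x) * K y - l / 2 * L y)) (Real.exp (-l * x) * C * 1 -
          ((1 - l / 2 * (y - x)) * (Real.exp (-l * y) * k y))) y := fun y hy =>
        ((hasDerivAt_id y).const_mul _).sub (hM y hy)
      have hmono : MonotoneOn (fun y => Real.exp (-l * x) * C * y -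
          ((1 + l / 2 * x) * K y - l / 2 * L y)) (Icc x (x + R)) := by
        refine monotoneOn_of_deriv_nonneg hconv
          (fun y hy => (hM2 y (hpos y hy)).continuousAt.continuousWithinAt)
          (fun y hy => (hM2 y (hpos y (interior_subset hy))).differentiableAt.differentiableWithinAt)
          fun y hy => ?_
        have hy := interior_subset hy
        rw [(hM2 y (hpos y hy)).deriv, mul_one, sub_nonneg]
        have h0 : 0 ≤ Real.exp (-l * y) * k y :=
          mul_nonneg (Real.exp_pos _).le (hk0 y (hpos y hy))
        refine (mul_le_of_le_one_left h0 (hw y hy).2).trans ?_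
        have : Real.exp (-l * y) ≤ Real.exp (-l * x) :=
          Real.exp_le_exp.2 (by nlinarith [hy.1])
        exact mul_le_mul this (hkC y (hpos y hy)) (hk0 y (hpos y hy)) (Real.exp_pos _).le
      have := hmono hmem hmem' (by linarith)
      simp only [hN]
      simp only at this
      linarith
  -- Since `c = l exp(-l R)`, the derivative of the averaging term cancels both `c f(x + R)` and the
  -- `-l f(x)` coming from the weight. The lower endpoint in `N'` cancels `-k(x)`, and the slope `-l
  -- / 2` of the weight in `N` produces the integral that absorbs `(c / 2) ∫ k`.
  set Q : ℝ → ℝ := fun x => Real.exp (-l * x) * f x - l * (V (x + R) - V x) - N x with hQ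
  have hQanti : AntitoneOn Q (Ioi 0) := by
    refine antitoneOn_Ioi_of_hasDerivAt (fun x hx => ((((hE x).mul (hf x hx)).sub
      (((hshift hV x hx).sub (hV x hx)).const_mul l))).sub
      (((((hasDerivAt_id x).const_mul (l / 2)).const_add 1).mul
        ((hshift hK x hx).sub (hK x hx))).sub
        (((hshift hL x hx).sub (hL x hx)).const_mul (l / 2)))) fun x hx => ?_
    -- On the window `exp(-l (x + R)) ≤ exp(-l y)`, so the unweighted integral of `k` is controlled
    -- by the weighted one.
    have hHK : Real.exp (-l * R) * (Real.exp (-l * x) * (H x - H (x + R))) ≤ K (x + R) - K x := by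
      have hmono : MonotoneOn (fun y => K y + Real.exp (-l * (x + R)) * H y) (Icc x (x + R)) := by
        have hd : ∀ y, 0 < y → HasDerivAt (fun y => K y + Real.exp (-l * (x + R)) * H y)
            (Real.exp (-l * y) * k y + Real.exp (-l * (x + R)) * -k y) y := fun y hy =>
          (hK y hy).add ((hH y hy).const_mul _)
        have hpos : ∀ y ∈ Icc x (x + R), 0 < y := fun y hy => hx.trans_le hy.1
        refine monotoneOn_of_deriv_nonneg (convex_Icc _ _)
          (fun y hy => (hd y (hpos y hy)).continuousAt.continuousWithinAt)
          (fun y hy => (hd y (hpos y (interior_subset hy))).differentiableAt.differentiableWithinAt)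
          fun y hy => ?_
        have hy := interior_subset hy
        rw [(hd y (hpos y hy)).deriv]
        have : Real.exp (-l * (x + R)) ≤ Real.exp (-l * y) :=
          Real.exp_le_exp.2 (by nlinarith [hy.2])
        nlinarith [hk0 y (hpos y hy)]
      have := hmono (⟨le_rfl, by linarith⟩ : x ∈ Icc x (x + R))
        (⟨by linarith, le_rfl⟩ : x + R ∈ Icc x (x + R)) (by linarith)
      simp only [hexpR] at this
      linarith
    have h1 := mul_le_mul_of_nonneg_left (h x hx) (Real.exp_pos (-l * x)).le
    have h2 : 0 ≤ (1 - l * R / 2) * (Real.exp (-l * (x + R)) * k (x + R)) :=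
      mul_nonneg (by linarith) (mul_nonneg (Real.exp_pos _).le (hk0 _ (by linarith)))
    have h3 := mul_le_mul_of_nonneg_left hHK hl.le
    simp only [hexpR, id, hc, Pi.sub_apply] at h1 h2 ⊢
    linarith
  refine nonneg_of_forward_average_le hR hl (fun x hx => neg_le_of_abs_le (hfC x hx)) hV
    fun x hx => ?_
  have hQlow : ∀ y, 0 < y → -((C + l * (R * C) + R * C) * Real.exp (-l * y)) ≤ Q y := by
    intro y hy
    have h1 : V (y + R) - V y ≤ R * C * Real.exp (-l * y) := by
      have hd : ∀ z, 0 < z → HasDerivAt (fun z => Real.exp (-l * y) * C * z - V z)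
          (Real.exp (-l * y) * C * 1 - Real.exp (-l * z) * f z) z := fun z hz =>
        ((hasDerivAt_id z).const_mul _).sub (hV z hz)
      have hpos : ∀ z ∈ Icc y (y + R), 0 < z := fun z hz => hy.trans_le hz.1
      have hmono : MonotoneOn (fun z => Real.exp (-l * y) * C * z - V z) (Icc y (y + R)) := by
        refine monotoneOn_of_deriv_nonneg (convex_Icc _ _)
          (fun z hz => (hd z (hpos z hz)).continuousAt.continuousWithinAt)
          (fun z hz => (hd z (hpos z (interior_subset hz))).differentiableAt.differentiableWithinAt)
          fun z hz => ?_
        have hz := interior_subset hz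
        rw [(hd z (hpos z hz)).deriv, mul_one, sub_nonneg]
        have : Real.exp (-l * z) ≤ Real.exp (-l * y) :=
          Real.exp_le_exp.2 (by nlinarith [hz.1])
        calc _ ≤ Real.exp (-l * z) * C := by
              gcongr; exact (le_abs_self _).trans (hfC z (hpos z hz))
          _ ≤ _ := by gcongr
      have := hmono (⟨le_rfl, by linarith⟩ : y ∈ Icc y (y + R))
        (⟨by linarith, le_rfl⟩ : y + R ∈ Icc y (y + R)) (by linarith)
      simp only at this
      linarith
    have h2 : -(Real.exp (-l * y) * C) ≤ Real.exp (-l * y) * f y := by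
      rw [← mul_neg]
      gcongr
      exact neg_le_of_abs_le (hfC y hy)
    have h3 := (hN0 y hy).2
    have h4 := mul_le_mul_of_nonneg_left h1 hl.le
    simp only [hQ]
    linarith
  have hlim : Tendsto (fun y => -((C + l * (R * C) + R * C) * Real.exp (-l * y))) atTop (𝓝 0) := by
    have : Tendsto (fun y => Real.exp (-l * y)) atTop (𝓝 0) :=
      Real.tendsto_exp_atBot.comp (tendsto_id.const_mul_atTop_of_neg (by linarith))
    simpa using (this.const_mul (C + l * (R * C) + R * C)).neg
  have hQ0 : 0 ≤ Q x := by
    refine le_of_tendsto hlim ?_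
    filter_upwards [eventually_ge_atTop x] with y hy
    exact (hQlow y (hx.trans_le hy)).trans (hQanti hx (mem_Ioi.2 (hx.trans_le hy)) hy)
  have := (hN0 x hx).1
  simp only [hQ] at hQ0
  linarith

/-! ### Superpositions of heat kernels and the heat flow. -/

theorem measurable_heatKernel_comp {α : Type*} [MeasurableSpace α] {s z : α → ℝ}
    (hs : Measurable s) (hz : Measurable z) : Measurable fun p => heatKernel (s p) (z p) :=
  measurable_heatKernel.comp (hs.prodMk hz)

theorem measurable_heatFlux_comp {α : Type*} [MeasurableSpace α] {s z : α → ℝ}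
    (hs : Measurable s) (hz : Measurable z) : Measurable fun p => heatFlux (s p) (z p) :=
  measurable_heatFlux.comp (hs.prodMk hz)

/-- Differentiation of superpositions of heat kernels. -/
theorem hasDerivAt_integral_heatKernel {α : Type*} [MeasurableSpace α] {μ : Measure α}
    {w s z b : α → ℝ} {r x₀ : ℝ} (hw : AEStronglyMeasurable w μ) (hs : Measurable s)
    (hz : Measurable z) (hr : r < x₀)
    (hi : Integrable (fun p => w p * heatKernel (s p) (x₀ + z p)) μ)
    (hb : ∀ᵐ p ∂μ, ∀ x, r < x → |w p * heatFlux (s p) (x + z p)| ≤ b p) (hbi : Integrable b μ) :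
    Integrable (fun p => w p * heatFlux (s p) (x₀ + z p)) μ ∧
      HasDerivAt (fun x => ∫ p, w p * heatKernel (s p) (x + z p) ∂μ)
        (-∫ p, w p * heatFlux (s p) (x₀ + z p) ∂μ) x₀ := by
  have h := hasDerivAt_integral_of_dominated_loc_of_deriv_le (μ := μ) (𝕜 := ℝ)
    (F := fun x p => w p * heatKernel (s p) (x + z p))
    (F' := fun x p => -(w p * heatFlux (s p) (x + z p))) (bound := b) (x₀ := x₀)
    (Ioi_mem_nhds hr)
    (Eventually.of_forall fun x =>
      hw.mul (measurable_heatKernel_comp hs (hz.const_add x)).aestronglyMeasurable)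
    hi (hw.mul (measurable_heatFlux_comp hs (hz.const_add x₀)).aestronglyMeasurable).neg
    (by
      filter_upwards [hb] with p hp x hx
      rw [norm_neg]
      exact hp x hx) hbi
    (ae_of_all _ fun p x _ => by
      have := ((hasDerivAt_heatKernel_heatFlux (s p) (x + z p)).comp_add_const x (z p)).const_mul (w p)
      exact this.congr_deriv (mul_neg _ _))
  refine ⟨by simpa using h.1.neg, ?_⟩
  rw [← integral_neg]
  exact h.2

theorem memLp_heatKernel_sub (s x : ℝ) :
    MemLp (fun y => heatKernel s (x - y)) 2 (volume : Measure ℝ) :=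
  (memLp_heatKernel s).comp_measurePreserving (Measure.measurePreserving_sub_left volume x)

theorem integrable_heatKernel_sub_mul (s x : ℝ) {f : ℝ → ℝ} (hf : MemLp f 2) :
    Integrable fun y => heatKernel s (x - y) * f y :=
  (memLp_heatKernel_sub s x).integrable_mul hf

theorem integrable_mul_heatKernel_sub (s x : ℝ) {f : ℝ → ℝ} (hf : MemLp f 2) :
    Integrable fun y => f y * heatKernel s (x - y) :=
  hf.integrable_mul (memLp_heatKernel_sub s x)

/-- The heat flow at `x` is continuous in `x`, for square integrable data. -/
theorem continuous_heatFlow {s : ℝ} (hs : 0 < s) {f : ℝ → ℝ} (hf : MemLp f 2) :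
    Continuous (heatFlow s f) := by
  refine continuous_iff_continuousAt.2 fun x₀ => ?_
  refine continuousAt_of_dominated (bound := fun y => Real.exp (1 / (4 * s)) * √2 *
    (‖heatKernel (2 * s) (x₀ - y) * f y‖)) (Eventually.of_forall fun x =>
      (integrable_heatKernel_sub_mul s x hf).aestronglyMeasurable) ?_
    ((integrable_heatKernel_sub_mul _ x₀ hf).norm.const_mul _) (ae_of_all _ fun y =>
      (((continuous_heatKernel s).comp (continuous_id.sub continuous_const)).mul
        continuous_const).continuousAt)
  filter_upwards [Metric.closedBall_mem_nhds x₀ one_pos] with x hx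
  refine ae_of_all _ fun y => ?_
  rw [norm_mul, norm_mul, Real.norm_of_nonneg (heatKernel_nonneg _ _),
    Real.norm_of_nonneg (heatKernel_nonneg _ _), ← mul_assoc]
  gcongr
  refine heatKernel_le_shift hs ?_
  rw [Metric.mem_closedBall, Real.dist_eq] at hx
  simpa using hx

theorem heatFlow_comp_neg (s : ℝ) (f : ℝ → ℝ) (x : ℝ) :
    heatFlow s (fun y => f (-y)) x = heatFlow s f (-x) := by
  unfold heatFlow
  rw [← integral_neg_eq_self]
  refine integral_congr_ae (ae_of_all _ fun y => ?_)
  simp only [neg_neg]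
  rw [← heatKernel_neg]
  ring_nf

theorem integrable_mul_heatKernel_add_abs {s R x : ℝ} (hx : 0 ≤ x) {f : ℝ → ℝ} (hf : MemLp f 2) :
    Integrable fun y => f y * heatKernel s (x + |R - y|) := by
  refine (integrable_mul_heatKernel_sub s R hf).mono
    (hf.aestronglyMeasurable.mul (measurable_heatKernel_comp measurable_const
      (by fun_prop)).aestronglyMeasurable) (ae_of_all _ fun y => ?_)
  rw [norm_mul, norm_mul, Real.norm_of_nonneg (heatKernel_nonneg _ _),
    Real.norm_of_nonneg (heatKernel_nonneg _ _), ← heatKernel_abs s (R - y)]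
  gcongr
  exact heatKernel_le_of_le (abs_nonneg _) (by linarith)

/-! ### First passage decomposition of mild solutions. -/

/-- First passage identity for diffusivity `D`. -/
theorem integral_heatFlux_mul_heatKernel_diffusivity {D t x y : ℝ} (hD : 0 < D) (ht : 0 < t)
    (hx : 0 < x) (hy : 0 < y) :
    ∫ s in (0 : ℝ)..t, 2 * D * heatFlux (D * (t - s)) x * heatKernel (D * s) y =
      heatKernel (D * t) (x + y) := by
  rw [← integral_heatFlux_mul_heatKernel (mul_pos hD ht) hx hy]
  have := intervalIntegral.integral_comp_mul_left (a := 0) (b := t)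
    (fun s => 2 * (heatFlux (D * t - s) x * heatKernel s y)) hD.ne'
  rw [mul_zero, smul_eq_mul, eq_inv_mul_iff_mul_eq₀ hD.ne'] at this
  rw [← this, ← intervalIntegral.integral_const_mul]
  congr 1
  ext s
  rw [mul_sub]
  ring

theorem integrableOn_heatFlux_mul_heatKernel {D t x y : ℝ} (hD : 0 < D)
    (hx : 0 < x) (hy : 0 < y) :
    Integrable (fun s => 2 * D * heatFlux (D * (t - s)) x * heatKernel (D * s) y)
      (volume.restrict (Ioc 0 t)) := by
  have hm : Measurable fun s => 2 * D * heatFlux (D * (t - s)) x * heatKernel (D * s) y :=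
    ((measurable_heatFlux_comp (by fun_prop) (by fun_prop)).const_mul _).mul
      (measurable_heatKernel_comp (by fun_prop) (by fun_prop))
  refine Integrable.of_bound (C := 2 * D * (16 * √(D * t) / x ^ 3) * (4 * √(D * t) / y ^ 2))
    hm.aestronglyMeasurable ((ae_restrict_iff' measurableSet_Ioc).2 (ae_of_all _ fun s hs => ?_))
  have h1 := heatFlux_nonneg (s := D * (t - s)) hx.le
  have h2 := heatKernel_nonneg (D * s) y
  rw [Real.norm_of_nonneg (by positivity)]
  have h3 : heatFlux (D * (t - s)) x ≤ 16 * √(D * t) / x ^ 3 :=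
    heatFlux_le hx le_rfl (by gcongr; linarith [hs.1])
  have h4 : heatKernel (D * s) y ≤ 4 * √(D * t) / y ^ 2 :=
    heatKernel_le hy le_rfl (by gcongr; exact hs.2)
  gcongr

/-- First passage decomposition of the heat flow: convolution in time of the values at `R` with
the first passage density gives the heat flow with `R` acting as a mirror. -/
theorem integral_heatFlux_mul_heatFlow {D t x R : ℝ} (hD : 0 < D) (ht : 0 < t) (hx : 0 < x)
    {f : ℝ → ℝ} (hfc : Continuous f) (hf : MemLp f 2) :
    Integrable (fun s => 2 * D * heatFlux (D * (t - s)) x * heatFlow (D * s) f R)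
        (volume.restrict (Ioc 0 t)) ∧
      ∫ s in (0 : ℝ)..t, 2 * D * heatFlux (D * (t - s)) x * heatFlow (D * s) f R =
        ∫ y, f y * heatKernel (D * t) (x + |R - y|) := by
  set F : ℝ → ℝ → ℝ := fun s y =>
    2 * D * heatFlux (D * (t - s)) x * heatKernel (D * s) (R - y) * f y with hF
  have hm : Measurable (Function.uncurry F) :=
    (((measurable_heatFlux_comp (by fun_prop) (by fun_prop)).const_mul _).mul
      (measurable_heatKernel_comp (by fun_prop) (by fun_prop))).mul
      (hfc.measurable.comp measurable_snd)
  -- The first passage identity needs a positive distance `|R - y|`; the exceptional point is null.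
  have hne : ∀ᵐ y : ℝ, y ≠ R := by simp [ae_iff, measure_singleton]
  have hval : ∀ y, y ≠ R → ∫ s in (0 : ℝ)..t,
      2 * D * heatFlux (D * (t - s)) x * heatKernel (D * s) (R - y) =
        heatKernel (D * t) (x + |R - y|) := fun y hy => by
    rw [← integral_heatFlux_mul_heatKernel_diffusivity hD ht hx
      (abs_pos.2 (sub_ne_zero.2 hy.symm))]
    simp only [heatKernel_abs]
  have hint : Integrable (Function.uncurry F) ((volume.restrict (Ioc 0 t)).prod volume) := by
    rw [integrable_prod_iff' hm.aestronglyMeasurable]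
    constructor
    · filter_upwards [hne] with y hy
      have := (integrableOn_heatFlux_mul_heatKernel (t := t) hD hx
        (abs_pos.2 (sub_ne_zero.2 hy.symm))).mul_const (f y)
      simp only [heatKernel_abs] at this
      exact this
    -- The integrand is nonnegative apart from `f y`, so its norm integrates in time, by the
    -- identity itself, to the mirrored kernel times `|f y|`.
    · refine (integrable_mul_heatKernel_add_abs (s := D * t) (R := R) hx.le hf).norm.congr ?_
      filter_upwards [hne] with y hy
      rw [norm_mul, Real.norm_of_nonneg (heatKernel_nonneg _ _), ← hval y hy,
        intervalIntegral.integral_of_le ht.le, ← integral_const_mul]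
      refine integral_congr_ae (ae_of_all _ fun s => ?_)
      have h1 := heatFlux_nonneg (s := D * (t - s)) hx.le
      have h2 := heatKernel_nonneg (D * s) (R - y)
      simp only [hF, Function.uncurry]
      rw [norm_mul, Real.norm_of_nonneg (by positivity : 0 ≤
        2 * D * heatFlux (D * (t - s)) x * heatKernel (D * s) (R - y)), mul_comm]
  have hflow : ∀ s, ∫ y, F s y = 2 * D * heatFlux (D * (t - s)) x * heatFlow (D * s) f R :=
    fun s => by
      simp only [hF, heatFlow, mul_assoc]
      simp only [integral_const_mul]
  constructor
  · refine hint.integral_prod_left.congr (ae_of_all _ fun s => ?_)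
    exact hflow s
  · rw [intervalIntegral.integral_of_le ht.le]
    simp only [← hflow]
    rw [integral_integral_swap hint]
    refine integral_congr_ae ?_
    filter_upwards [hne] with y hy
    rw [← hval y hy, intervalIntegral.integral_of_le ht.le, mul_comm, ← integral_mul_const]

/-- A time translation by `r` of the first passage identity: the kernel vanishes at nonpositive
times, so only `s > r` counts. -/
theorem integral_heatFlux_mul_heatKernel_sub {D t r x R : ℝ} (hD : 0 < D) (hx : 0 < x)
    (hR : 0 < R) (hr : r ∈ Ioo 0 t) :
    ∫ s in (0 : ℝ)..t, 2 * D * heatFlux (D * (t - s)) x * heatKernel (D * (s - r)) R =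
      heatKernel (D * (t - r)) (x + R) := by
  have hz : ∀ s ∈ Ioc 0 r, 2 * D * heatFlux (D * (t - s)) x * heatKernel (D * (s - r)) R = 0 :=
    fun s hs => by
      rw [heatKernel_of_nonpos (mul_nonpos_of_nonneg_of_nonpos hD.le (by linarith [hs.2])), mul_zero]
  have h1 := intervalIntegral.integral_comp_sub_right (a := r) (b := t)
    (fun s => 2 * D * heatFlux (D * (t - r - s)) x * heatKernel (D * s) R) r
  simp only [sub_self, sub_sub, add_sub_cancel] at h1
  have hshift : ∫ s in r..t, 2 * D * heatFlux (D * (t - s)) x * heatKernel (D * (s - r)) R =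
      heatKernel (D * (t - r)) (x + R) := by
    rw [h1, ← integral_heatFlux_mul_heatKernel_diffusivity hD (sub_pos.2 hr.2) hx hR]
    simp only [sub_sub]
  rw [← hshift, intervalIntegral.integral_of_le (hr.1.trans hr.2).le,
    intervalIntegral.integral_of_le hr.2.le]
  refine setIntegral_eq_of_subset_of_forall_sdiff_eq_zero measurableSet_Ioc
    (Ioc_subset_Ioc_left hr.1.le) fun s hs => hz s ⟨hs.1.1, ?_⟩
  by_contra hlt
  exact hs.2 ⟨not_le.1 hlt, hs.1.2⟩

/-- First passage decomposition of the Duhamel term. -/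
theorem integral_heatFlux_mul_duhamel {D t x R : ℝ} (hD : 0 < D) (ht : 0 < t) (hx : 0 < x)
    (hR : 0 < R) {Ψ : ℝ → ℝ} (hΨ : Integrable Ψ (volume.restrict (Ioc 0 t))) :
    Integrable (fun s => 2 * D * heatFlux (D * (t - s)) x *
        ∫ r in (0 : ℝ)..s, Ψ r * heatKernel (D * (s - r)) R) (volume.restrict (Ioc 0 t)) ∧
      ∫ s in (0 : ℝ)..t, 2 * D * heatFlux (D * (t - s)) x *
          ∫ r in (0 : ℝ)..s, Ψ r * heatKernel (D * (s - r)) R =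
        ∫ r in (0 : ℝ)..t, Ψ r * heatKernel (D * (t - r)) (x + R) := by
  set F : ℝ → ℝ → ℝ := fun s r =>
    2 * D * heatFlux (D * (t - s)) x * heatKernel (D * (s - r)) R * Ψ r with hF
  have hint : Integrable (Function.uncurry F)
      ((volume.restrict (Ioc 0 t)).prod (volume.restrict (Ioc 0 t))) := by
    have hm : Measurable fun p : ℝ × ℝ =>
        2 * D * heatFlux (D * (t - p.1)) x * heatKernel (D * (p.1 - p.2)) R :=
      ((measurable_heatFlux_comp (by fun_prop) (by fun_prop)).const_mul _).mul
        (measurable_heatKernel_comp (by fun_prop) (by fun_prop))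
    refine (hΨ.comp_snd (volume.restrict (Ioc 0 t))).bdd_mul
      (c := 2 * D * (16 * √(D * t) / x ^ 3) * (4 * √(D * t) / R ^ 2))
      hm.aestronglyMeasurable ?_
    rw [Measure.prod_restrict]
    refine (ae_restrict_iff' (measurableSet_Ioc.prod measurableSet_Ioc)).2
      (ae_of_all _ fun p hp => ?_)
    have h1 := heatFlux_nonneg (s := D * (t - p.1)) hx.le
    have h2 := heatKernel_nonneg (D * (p.1 - p.2)) R
    rw [Real.norm_of_nonneg (by positivity)]
    have h3 : heatFlux (D * (t - p.1)) x ≤ 16 * √(D * t) / x ^ 3 :=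
      heatFlux_le hx le_rfl (by gcongr; linarith [hp.1.1])
    have h4 : heatKernel (D * (p.1 - p.2)) R ≤ 4 * √(D * t) / R ^ 2 :=
      heatKernel_le hR le_rfl (by gcongr; linarith [hp.1.2, hp.2.1])
    gcongr
  -- The value `0` of the kernel at nonpositive times lets the triangle `r ≤ s` be replaced by a
  -- square, where Fubini applies directly.
  have hflow : ∀ s ∈ Ioc 0 t, ∫ r in Ioc 0 t, F s r =
      2 * D * heatFlux (D * (t - s)) x * ∫ r in (0 : ℝ)..s, Ψ r * heatKernel (D * (s - r)) R := by
    intro s hs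
    rw [intervalIntegral.integral_of_le hs.1.le, ← integral_const_mul]
    rw [setIntegral_eq_of_subset_of_forall_sdiff_eq_zero measurableSet_Ioc
      (Ioc_subset_Ioc_right hs.2) (f := F s)]
    · refine integral_congr_ae (ae_of_all _ fun r => ?_)
      simp only [hF]; ring
    · intro r hr
      have : s < r := by
        by_contra hlt
        exact hr.2 ⟨hr.1.1, not_lt.1 hlt⟩
      simp only [hF]
      rw [heatKernel_of_nonpos (mul_nonpos_of_nonneg_of_nonpos hD.le (by linarith)), mul_zero,
        zero_mul]
  constructor
  · refine hint.integral_prod_left.congr ((ae_restrict_iff' measurableSet_Ioc).2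
      (ae_of_all _ fun s hs => ?_))
    exact hflow s hs
  · rw [intervalIntegral.integral_of_le ht.le, ← setIntegral_congr_fun measurableSet_Ioc hflow,
      integral_integral_swap hint, intervalIntegral.integral_of_le ht.le]
    rw [integral_Ioc_eq_integral_Ioo, integral_Ioc_eq_integral_Ioo]
    refine setIntegral_congr_fun measurableSet_Ioo fun r hr => ?_
    simp only [hF]
    rw [integral_mul_const, ← intervalIntegral.integral_of_le ht.le,
      integral_heatFlux_mul_heatKernel_sub hD hx hR hr, mul_comm]

/-- The characteristic equation of the delay equation `X' = -c X(· - R)` has a real root as soon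
as `c R ≤ 1 / e`. -/
theorem exists_delay_characteristic_root {c R : ℝ} (hR : 0 < R) (hc : 0 < c)
    (h : c * R ≤ Real.exp (-1)) :
    ∃ l, 0 < l ∧ l * R ≤ 1 ∧ c = l * Real.exp (-l * R) := by
  -- With `m = l R`, the equation reads `m exp(-m) = c R`; on `[0, 1]` the left side runs from `0`
  -- to `1/e`.
  have hcont : ContinuousOn (fun m : ℝ => m * Real.exp (-m)) (Icc 0 1) := by fun_prop
  obtain ⟨m, hm, hmc⟩ := intermediate_value_Icc zero_le_one hcont
    (⟨by simpa using (mul_pos hc hR).le, by simpa using h⟩ :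
      c * R ∈ Icc ((0 : ℝ) * Real.exp (-0)) (1 * Real.exp (-1)))
  have hm0 : m ≠ 0 := by
    rintro rfl
    simp only [zero_mul] at hmc
    exact (mul_pos hc hR).ne hmc
  refine ⟨m / R, div_pos (lt_of_le_of_ne hm.1 hm0.symm) hR, ?_, ?_⟩
  · rw [div_mul_cancel₀ _ hR.ne']; exact hm.2
  · rw [neg_mul, div_mul_cancel₀ _ hR.ne', div_mul_eq_mul_div, eq_div_iff hR.ne']
    exact hmc.symm

/-- First passage decomposition of a function satisfying the variation of constants formula. -/
theorem integral_heatFlux_mul_mild {D t x R : ℝ} (hD : 0 < D) (ht : 0 < t) (hx : 0 < x)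
    (hR : 0 < R) {f Ψ U : ℝ → ℝ} (hfc : Continuous f) (hf : MemLp f 2)
    (hΨ : Integrable Ψ (volume.restrict (Ioc 0 t)))
    (hU : ∀ s ∈ Ioc 0 t, U s = heatFlow (D * s) f R +
      ∫ r in (0 : ℝ)..s, Ψ r * heatKernel (D * (s - r)) R) :
    Integrable (fun s => 2 * D * heatFlux (D * (t - s)) x * U s) (volume.restrict (Ioc 0 t)) ∧
      ∫ s in Ioc 0 t, 2 * D * heatFlux (D * (t - s)) x * U s =
        (∫ y, f y * heatKernel (D * t) (x + |R - y|)) +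
          ∫ r in Ioc 0 t, Ψ r * heatKernel (D * (t - r)) (x + R) := by
  obtain ⟨i1, e1⟩ := integral_heatFlux_mul_heatFlow (R := R) hD ht hx hfc hf
  obtain ⟨i2, e2⟩ := integral_heatFlux_mul_duhamel hD ht hx hR hΨ
  have hUe : ∀ s ∈ Ioc 0 t, 2 * D * heatFlux (D * (t - s)) x * heatFlow (D * s) f R +
      2 * D * heatFlux (D * (t - s)) x * ∫ r in (0 : ℝ)..s, Ψ r * heatKernel (D * (s - r)) R =
      2 * D * heatFlux (D * (t - s)) x * U s := fun s hs => by rw [hU s hs, mul_add]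
  rw [intervalIntegral.integral_of_le ht.le] at e1 e2
  rw [intervalIntegral.integral_of_le ht.le] at e2
  rw [← e1, ← e2, ← integral_add i1 i2]
  exact ⟨(i1.add i2).congr ((ae_restrict_iff' measurableSet_Ioc).2 (ae_of_all _ hUe)),
    (setIntegral_congr_fun measurableSet_Ioc hUe).symm⟩

/-! ### Asymmetry of the data and derivatives of the mirrored terms. -/

/-- If `f` is symmetric off `(-R/2, R/2)`, the effect of its asymmetry on the mirrored heat flow is
controlled by the mass on the negative half of that interval. -/
theorem integral_asymmetry_mul_heatKernel_le {R T x : ℝ} (hR : 0 < R) (hx : 0 ≤ x) {f : ℝ → ℝ}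
    (hfc : Continuous f) (hf0 : ∀ y, 0 ≤ f y)
    (hsymm : ∀ y ∉ Ioo (-(R / 2)) (R / 2), f (-y) = f y) :
    ∫ y, (f (-y) - f y) * heatKernel T (x + R + |R - y|) ≤
      (∫ y in Ioc 0 (R / 2), f (-y) * heatKernel T (x + (R + y))) -
        ∫ y in Ioc 0 (R / 2), f (-y) * heatKernel T (x + R + (R + y)) := by
  have hK := continuous_heatKernel T
  set g : ℝ → ℝ := fun y => (f (-y) - f y) * heatKernel T (x + R + |R - y|) with hg
  have hgc : Continuous g := by
    have : Continuous fun y => heatKernel T (x + R + |R - y|) := hK.comp (by fun_prop)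
    fun_prop
  have hgi : ∀ a b, IntervalIntegrable g volume a b := fun a b => hgc.intervalIntegrable a b
  have h1 : ∫ y, g y = ∫ y in (-(R / 2))..(R / 2), g y := by
    rw [intervalIntegral.integral_of_le (by linarith), integral_Ioc_eq_integral_Ioo,
      setIntegral_eq_integral_of_forall_compl_eq_zero]
    intro y hy
    simp only [hg, hsymm y hy, sub_self, zero_mul]
  have h2 : ∫ y in (-(R / 2))..0, g y = ∫ y in (0 : ℝ)..(R / 2), g (-y) := by
    rw [intervalIntegral.integral_comp_neg, neg_zero]
  have hc1 : ∀ d : ℝ, Continuous fun y => f (-y) * heatKernel T (d + (R + y)) := fun d => by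
    have : Continuous fun y => heatKernel T (d + (R + y)) := hK.comp (by fun_prop)
    fun_prop
  have hgn : Continuous fun y => g (-y) := hgc.comp continuous_neg
  rw [h1, ← intervalIntegral.integral_add_adjacent_intervals (hgi _ 0) (hgi 0 _), h2,
    ← intervalIntegral.integral_add (hgn.intervalIntegrable _ _) (hgi _ _),
    ← intervalIntegral.integral_of_le (by linarith), ← intervalIntegral.integral_of_le (by linarith),
    ← intervalIntegral.integral_sub ((hc1 _).intervalIntegrable _ _)
      ((hc1 _).intervalIntegrable _ _)]
  refine intervalIntegral.integral_mono_on (by linarith) ((hgn.add hgc).intervalIntegrable _ _)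
    (((hc1 _).sub (hc1 _)).intervalIntegrable _ _) fun y hy => ?_
  have ey : |R - y| = R - y := abs_of_nonneg (by linarith [hy.2])
  have ey' : |R - -y| = R + y := by rw [sub_neg_eq_add]; exact abs_of_nonneg (by linarith [hy.1])
  simp only [hg, ey, ey', neg_neg]
  -- This is where `R / 2` matters: `2 R - y ≥ R + y` exactly when `y ≤ R / 2`. Folding at the
  -- origin leaves `(f(-y) - f(y))` times a nonnegative kernel difference by `k2`, so the `f(y)`
  -- part can be dropped.
  have k1 : heatKernel T (x + R + (R - y)) ≤ heatKernel T (x + (R + y)) :=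
    heatKernel_le_of_le (by linarith [hy.1]) (by linarith [hy.2])
  have k2 : heatKernel T (x + R + (R + y)) ≤ heatKernel T (x + R + (R - y)) :=
    heatKernel_le_of_le (by linarith [hy.2]) (by linarith [hy.1])
  nlinarith [mul_le_mul_of_nonneg_left k1 (hf0 (-y)), mul_le_mul_of_nonneg_left k2 (hf0 y)]

theorem integral_heatFlux_Ioc_le {R T x : ℝ} (hx : 0 ≤ x) {f : ℝ → ℝ} (hR : 0 < R)
    (hf0 : ∀ y, 0 ≤ f y) (hi : Integrable fun y => f y * heatFlux T (x + |R - y|)) :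
    ∫ y in Ioc 0 (R / 2), f (-y) * heatFlux T (x + (R + y)) ≤
      ∫ y, f y * heatFlux T (x + |R - y|) := by
  have h0 : ∀ y, 0 ≤ f y * heatFlux T (x + |R - y|) := fun y =>
    mul_nonneg (hf0 y) (heatFlux_nonneg (by positivity))
  have e : ∀ y ∈ Ioc 0 (R / 2), f (-y) * heatFlux T (x + (R + y)) =
      f (-y) * heatFlux T (x + |R - -y|) := fun y hy => by
    rw [sub_neg_eq_add, abs_of_nonneg (by linarith [hy.1])]
  rw [setIntegral_congr_fun measurableSet_Ioc e,
    ← integral_neg_eq_self fun y => f y * heatFlux T (x + |R - y|)]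
  exact setIntegral_le_integral hi.comp_neg (ae_of_all _ fun y => h0 (-y))

theorem integrable_mul_abs_heatKernel_two_mul {T R : ℝ} {f : ℝ → ℝ} (hf : MemLp f 2) :
    Integrable fun y => |f y| * ((1 + 8 * T) / (2 * T) * √2 * heatKernel (2 * T) (R - y)) := by
  refine ((integrable_mul_heatKernel_sub (2 * T) R hf).norm.const_mul
    ((1 + 8 * T) / (2 * T) * √2)).congr (ae_of_all _ fun y => ?_)
  simp only [norm_mul, Real.norm_eq_abs, abs_of_nonneg (heatKernel_nonneg _ _)]
  ring

/-- Domination holds because the flux is bounded by a kernel at time `2 T`, which only grows when `x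
+ |R - y|` is shortened to `|R - y|`. -/
theorem hasDerivAt_integral_mirror {T R x : ℝ} (hT : 0 < T) (hx : 0 < x) {f : ℝ → ℝ}
    (hf : MemLp f 2) :
    Integrable (fun y => f y * heatFlux T (x + |R - y|)) ∧
      HasDerivAt (fun x => ∫ y, f y * heatKernel T (x + |R - y|))
        (-∫ y, f y * heatFlux T (x + |R - y|)) x := by
  refine hasDerivAt_integral_heatKernel (s := fun _ => T) (z := fun y => |R - y|) (r := 0)
    (b := fun y => |f y| * ((1 + 8 * T) / (2 * T) * √2 * heatKernel (2 * T) (R - y)))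
    hf.aestronglyMeasurable measurable_const (by fun_prop) hx
    (integrable_mul_heatKernel_add_abs hx.le hf) (ae_of_all _ fun y z hz => ?_)
    (integrable_mul_abs_heatKernel_two_mul (R := R) hf)
  rw [abs_mul, abs_of_nonneg (heatFlux_nonneg (by positivity))]
  gcongr
  refine (heatFlux_le_heatKernel_two_mul hT _).trans ?_
  rw [← heatKernel_abs (2 * T) (R - y)]
  gcongr
  exact heatKernel_le_of_le (abs_nonneg _) (by linarith)

theorem integrable_mul_heatKernel_time {D t R x : ℝ} (hD : 0 < D) (hR : 0 < R) (hx : 0 ≤ x)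
    {Ψ : ℝ → ℝ} (hΨ : Integrable Ψ (volume.restrict (Ioc 0 t))) :
    Integrable (fun r => Ψ r * heatKernel (D * (t - r)) (x + R)) (volume.restrict (Ioc 0 t)) := by
  refine hΨ.mul_bdd (c := 4 * √(D * t) / R ^ 2) (measurable_heatKernel_comp (by fun_prop)
    (by fun_prop)).aestronglyMeasurable ((ae_restrict_iff' measurableSet_Ioc).2
      (ae_of_all _ fun r hr => ?_))
  rw [Real.norm_of_nonneg (heatKernel_nonneg _ _)]
  exact heatKernel_le hR (by linarith) (by gcongr; linarith [hr.1])

theorem hasDerivAt_integral_duhamel {D t R x : ℝ} (hD : 0 < D) (hR : 0 < R) (hx : 0 < x)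
    {Ψ : ℝ → ℝ} (hΨ : Integrable Ψ (volume.restrict (Ioc 0 t))) :
    Integrable (fun r => Ψ r * heatFlux (D * (t - r)) (x + R)) (volume.restrict (Ioc 0 t)) ∧
      HasDerivAt (fun x => ∫ r in Ioc 0 t, Ψ r * heatKernel (D * (t - r)) (x + R))
        (-∫ r in Ioc 0 t, Ψ r * heatFlux (D * (t - r)) (x + R)) x := by
  refine hasDerivAt_integral_heatKernel (s := fun r => D * (t - r)) (z := fun _ => R) (r := 0)
    (b := fun r => |Ψ r| * (16 * √(D * t) / R ^ 3))
    hΨ.aestronglyMeasurable (by fun_prop) measurable_const hx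
    (integrable_mul_heatKernel_time hD hR hx.le hΨ) ((ae_restrict_iff' measurableSet_Ioc).2
      (ae_of_all _ fun r hr z hz => ?_)) (hΨ.abs.mul_const _)
  rw [abs_mul, abs_of_nonneg (heatFlux_nonneg (by positivity))]
  gcongr
  exact heatFlux_le hR (by linarith) (by gcongr; linarith [hr.1])

theorem hasDerivAt_integral_Ioc_heatKernel {T R x : ℝ} (hR : 0 < R) (hx : 0 < x)
    {f : ℝ → ℝ} (hf : Continuous f) :
    HasDerivAt (fun x => ∫ y in Ioc 0 (R / 2), f (-y) * heatKernel T (x + (R + y)))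
        (-∫ y in Ioc 0 (R / 2), f (-y) * heatFlux T (x + (R + y))) x := by
  have hfn : Continuous fun y => f (-y) := by fun_prop
  have hi : Integrable (fun y => f (-y)) (volume.restrict (Ioc 0 (R / 2))) :=
    (hfn.integrableOn_Icc).mono_set Ioc_subset_Icc_self
  have hc : Continuous fun y => f (-y) * heatKernel T (x + (R + y)) :=
    hfn.mul ((continuous_heatKernel T).comp (by fun_prop))
  refine (hasDerivAt_integral_heatKernel (s := fun _ => T) (z := fun y => R + y) (r := 0)
    (b := fun y => |f (-y)| * (16 * √T / R ^ 3))
    hfn.aestronglyMeasurable measurable_const (by fun_prop) hx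
    ((hc.integrableOn_Icc).mono_set Ioc_subset_Icc_self)
    ((ae_restrict_iff' measurableSet_Ioc).2
      (ae_of_all _ fun y hy z hz => ?_)) (hi.abs.mul_const _)).2
  rw [abs_mul, abs_of_nonneg (heatFlux_nonneg (by linarith [hy.1]))]
  gcongr
  exact heatFlux_le hR (by linarith [hy.1]) le_rfl

/-! ### Positivity on the half-line beyond the sensor. -/

/-- Nonnegativity to the right of `R` for functions given by the variation of constants formula
with feedback from the values `U`, `U'` at `R` and `-R`. -/
theorem heatFlow_add_duhamel_nonneg {D R a t : ℝ} (hD : 0 < D) (hR : 0 < R) (ht : 0 < t)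
    (ha : a * R / D ∈ Ioc 0 (Real.exp (-1))) {Φ f U U' : ℝ → ℝ}
    (hΦ : Integrable Φ (volume.restrict (Ioc 0 t)))
    (hΦ0 : ∀ᵐ s ∂(volume.restrict (Ioc 0 t)), 0 ≤ Φ s)
    (hfc : Continuous f) (hf : MemLp f 2) (hf0 : ∀ y, 0 ≤ f y)
    (hsymm : ∀ y ∉ Ioo (-(R / 2)) (R / 2), f (-y) = f y)
    (hΨ : Integrable (fun s => Φ s - a * (U s + U' s)) (volume.restrict (Ioc 0 t)))
    (hU : ∀ s ∈ Ioc 0 t, U s = heatFlow (D * s) f R +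
      ∫ r in (0 : ℝ)..s, (Φ r - a * (U r + U' r)) * heatKernel (D * (s - r)) R)
    (hU' : ∀ s ∈ Ioc 0 t, U' s = heatFlow (D * s) f (-R) +
      ∫ r in (0 : ℝ)..s, (Φ r - a * (U r + U' r)) * heatKernel (D * (s - r)) R)
    {x : ℝ} (hx : 0 < x) :
    0 ≤ heatFlow (D * t) f (x + R) +
      ∫ r in (0 : ℝ)..t, (Φ r - a * (U r + U' r)) * heatKernel (D * (t - r)) (x + R) := by
  set Ψ : ℝ → ℝ := fun s => Φ s - a * (U s + U' s) with hΨdef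
  set T := D * t with hTdef
  have hT : 0 < T := mul_pos hD ht
  have ha0 : 0 < a := by
    have := ha.1
    rw [mul_div_assoc] at this
    exact pos_of_mul_pos_left this (by positivity)
  obtain ⟨l, hl, hlR, hlc⟩ := exists_delay_characteristic_root (c := a / D) hR (by positivity)
    (by rw [div_mul_eq_mul_div]; exact ha.2)
  have hfn : MemLp (fun y => f (-y)) 2 :=
    hf.comp_measurePreserving (Measure.measurePreserving_neg volume)
  have hfnc : Continuous fun y => f (-y) := by fun_prop
  set I : ℝ → ℝ := fun x => ∫ y, f y * heatKernel T (x + |R - y|) with hI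
  set J : ℝ → ℝ := fun x => ∫ r in Ioc 0 t, Ψ r * heatKernel (D * (t - r)) (x + R) with hJ
  set H : ℝ → ℝ := fun x => ∫ y in Ioc 0 (R / 2), f (-y) * heatKernel T (x + (R + y)) with hH
  set k : ℝ → ℝ := fun x => ∫ y in Ioc 0 (R / 2), f (-y) * heatFlux T (x + (R + y)) with hk
  set C : ℝ := (∫ y, f y * heatKernel T (R - y)) + ∫ r in Ioc 0 t, |Ψ r| * (4 * √T / R ^ 2) with hC
  set C' : ℝ := ∫ y in Ioc 0 (R / 2), f (-y) * (16 * √T / R ^ 3) with hC'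
  have hIC : ∀ x, 0 < x → |I x| ≤ ∫ y, f y * heatKernel T (R - y) := fun x hx => by
    rw [abs_of_nonneg (integral_nonneg fun y => mul_nonneg (hf0 y) (heatKernel_nonneg _ _))]
    refine integral_mono (integrable_mul_heatKernel_add_abs hx.le hf)
      (integrable_mul_heatKernel_sub T R hf) fun y => ?_
    simp only
    rw [← heatKernel_abs T (R - y)]
    exact mul_le_mul_of_nonneg_left (heatKernel_le_of_le (abs_nonneg _) (by linarith)) (hf0 y)
  have hJC : ∀ x, 0 < x → |J x| ≤ ∫ r in Ioc 0 t, |Ψ r| * (4 * √T / R ^ 2) := fun x hx => by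
    rw [← Real.norm_eq_abs]
    refine norm_integral_le_of_norm_le (hΨ.abs.mul_const _)
      ((ae_restrict_iff' measurableSet_Ioc).2 (ae_of_all _ fun r hr => ?_))
    rw [norm_mul, Real.norm_of_nonneg (heatKernel_nonneg _ _), Real.norm_eq_abs]
    gcongr
    exact heatKernel_le hR (by linarith) (by rw [hTdef]; gcongr; linarith [hr.1])
  have hkint : ∀ x, Integrable (fun y => f (-y) * heatFlux T (x + (R + y)))
      (volume.restrict (Ioc 0 (R / 2))) := fun x =>
    ((hfnc.mul ((continuous_heatFlux T).comp (by fun_prop))).integrableOn_Icc).mono_set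
      Ioc_subset_Icc_self
  have hkc : Continuous k := by
    have : k = fun x => ∫ y in (0 : ℝ)..(R / 2), f (-y) * heatFlux T (x + (R + y)) := by
      funext x; rw [intervalIntegral.integral_of_le (by positivity)]
    rw [this]
    refine intervalIntegral.continuous_parametric_intervalIntegral_of_continuous'
      ?_ 0 (R / 2)
    exact (hfc.comp (by fun_prop)).mul ((continuous_heatFlux T).comp (by fun_prop))
  have hk0 : ∀ x, 0 < x → 0 ≤ k x := fun x hx =>
    setIntegral_nonneg measurableSet_Ioc fun y hy =>
      mul_nonneg (hf0 _) (heatFlux_nonneg (by linarith [hy.1]))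
  have hkC : ∀ x, 0 < x → k x ≤ C' := fun x hx =>
    setIntegral_mono_on (hkint x)
      (((hfnc.mul continuous_const).integrableOn_Icc).mono_set Ioc_subset_Icc_self)
      measurableSet_Ioc fun y hy =>
        mul_le_mul_of_nonneg_left (heatFlux_le hR (by linarith [hy.1]) le_rfl) (hf0 _)
  have hderiv : ∀ x, 0 < x → HasDerivAt (fun x => I x + J x)
      (-(∫ y, f y * heatFlux T (x + |R - y|)) +
        -∫ r in Ioc 0 t, Ψ r * heatFlux (D * (t - r)) (x + R)) x := fun x hx =>
    (hasDerivAt_integral_mirror hT hx hf).2.add (hasDerivAt_integral_duhamel hD hR hx hΨ).2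
  -- The advanced inequality. Of the initial flux only the part `k` from `[-R/2, 0)` is kept, and
  -- the nonnegative contribution of `Φ` is discarded.
  have hineq : ∀ x, 0 < x → -(∫ y, f y * heatFlux T (x + |R - y|)) +
      -(∫ r in Ioc 0 t, Ψ r * heatFlux (D * (t - r)) (x + R)) ≤
      a / D * (I (x + R) + J (x + R)) - k x + a / D / 2 * (H x - H (x + R)) := by
    intro x hx
    have hxR : 0 < x + R := by positivity
    have hkx : k x ≤ ∫ y, f y * heatFlux T (x + |R - y|) :=
      integral_heatFlux_Ioc_le hx.le hR hf0 (hasDerivAt_integral_mirror hT hx hf).1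
    obtain ⟨i1, e1⟩ := integral_heatFlux_mul_mild hD ht hxR hR hfc hf hΨ hU
    obtain ⟨i2, e2⟩ := integral_heatFlux_mul_mild hD ht hxR hR hfnc hfn hΨ (U := U')
      (fun s hs => by rw [heatFlow_comp_neg]; exact hU' s hs)
    have hasym := integral_asymmetry_mul_heatKernel_le (T := T) hR hx.le hfc hf0 hsymm
    have e3 : ∫ y, (f (-y) - f y) * heatKernel T (x + R + |R - y|) =
        (∫ y, f (-y) * heatKernel T (x + R + |R - y|)) - I (x + R) := by
      simp only [sub_mul]
      exact integral_sub (integrable_mul_heatKernel_add_abs hxR.le hfn)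
        (integrable_mul_heatKernel_add_abs hxR.le hf)
    -- The feedback part of the Duhamel flux is a first passage integral at distance `x + R`; `e1`
    -- and `e2` evaluate it.
    have hsplit : ∫ r in Ioc 0 t, Ψ r * heatFlux (D * (t - r)) (x + R) =
        (∫ r in Ioc 0 t, Φ r * heatFlux (D * (t - r)) (x + R)) - a / (2 * D) *
          ((∫ s in Ioc 0 t, 2 * D * heatFlux (D * (t - s)) (x + R) * U s) +
            ∫ s in Ioc 0 t, 2 * D * heatFlux (D * (t - s)) (x + R) * U' s) := by
      have i3 : Integrable (fun s => a / (2 * D) * (2 * D * heatFlux (D * (t - s)) (x + R) * U s +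
          2 * D * heatFlux (D * (t - s)) (x + R) * U' s)) (volume.restrict (Ioc 0 t)) :=
        (i1.add i2).const_mul _
      rw [← integral_add i1 i2, ← integral_const_mul,
        ← integral_sub (hasDerivAt_integral_duhamel hD hR hx hΦ).1 i3]
      refine integral_congr_ae (ae_of_all _ fun r => ?_)
      simp only [hΨdef]
      field_simp
    have hΦq : 0 ≤ ∫ r in Ioc 0 t, Φ r * heatFlux (D * (t - r)) (x + R) :=
      integral_nonneg_of_ae <| by
        filter_upwards [hΦ0] with r hr
        exact mul_nonneg hr (heatFlux_nonneg hxR.le)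
    rw [e3] at hasym
    rw [hsplit, e1, e2]
    have hasym' := mul_le_mul_of_nonneg_left hasym (by positivity : 0 ≤ a / D / 2)
    have e4 : a / (2 * D) = a / D / 2 := by field_simp
    rw [e4]
    simp only [hI, hJ, hH] at hasym' ⊢
    linarith
  have hmain := nonneg_of_advanced_deriv_le (C := max C C') hR hl hlR hlc hderiv
    (fun x hx => ((abs_add_le _ _).trans (add_le_add (hIC x hx) (hJC x hx))).trans
      (le_max_left _ _))
    (fun x hx => hasDerivAt_integral_Ioc_heatKernel hR hx hfc) hkc.continuousOn hk0
    (fun x hx => (hkC x hx).trans (le_max_right _ _)) hineq x hx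
  -- What remains is the Dirichlet part of the heat flow, nonnegative since the mirrored distance `x
  -- + |R - y|` is at least `|x + R - y|`.
  refine hmain.trans ?_
  rw [intervalIntegral.integral_of_le ht.le]
  refine add_le_add_left ?_ _
  refine integral_mono (integrable_mul_heatKernel_add_abs hx.le hf)
    (integrable_heatKernel_sub_mul T _ hf) fun y => ?_
  simp only
  rw [mul_comm, ← heatKernel_abs T (x + R - y)]
  refine mul_le_mul_of_nonneg_right (heatKernel_le_of_le (abs_nonneg _) ?_) (hf0 y)
  rw [add_sub_assoc]
  exact (abs_add_le _ _).trans (by rw [abs_of_pos hx])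

/-! ### From the Bochner integral in `H1` to point values. -/

/-- Banach–Steinhaus: pointwise limits of continuous functionals on a complete space are continuous.
-/
theorem exists_continuousLinearMap_of_tendsto {E α : Type*} [NormedAddCommGroup E]
    [NormedSpace ℝ E] [CompleteSpace E] {l : Filter α} [l.IsCountablyGenerated] [l.NeBot]
    {g : α → E →L[ℝ] ℝ} {f : E → ℝ} (h : ∀ x, Tendsto (fun n => g n x) l (𝓝 (f x))) :
    ∃ L : E →L[ℝ] ℝ, ∀ x, L x = f x :=
  ⟨continuousLinearMapOfTendsto g (tendsto_pi_nhds.2 h), fun _ => rfl⟩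

theorem H1.rep_eq_of_ae_eq {f : H1} {F : ℝ → ℝ} (hF : Continuous F) (h : f.rep =ᵐ[volume] F) :
    f.rep = F :=
  (Continuous.ae_eq_iff_eq volume f.continuous_rep hF).1 h

theorem H1.memLp_rep (f : H1) : MemLp f.rep 2 (volume : Measure ℝ) :=
  (Lp.memLp f.1.fst).ae_eq f.coeFn_ae_eq_rep

/-- Point evaluation is a continuous linear functional on `H¹(ℝ)`. -/
theorem H1.exists_evaluation (x : ℝ) : ∃ L : H1 →L[ℝ] ℝ, ∀ f : H1, L f = f.rep x := by
  let fstH1 : H1 →L[ℝ] Lp ℝ 2 (volume : Measure ℝ) := WithLp.fstL 2 ℝ _ _ ∘L sobolevH1.subtypeL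
  -- Averages over `(x, x + h]` are `L²` inner products with indicators, and they converge to the
  -- point value as `h → 0+` by continuity of the representative.
  let A : ℝ → H1 →L[ℝ] ℝ := fun h => h⁻¹ • ((innerSL ℝ
    (indicatorConstLp 2 (measurableSet_Ioc (a := x) (b := x + h)) (by simp) (1 : ℝ))) ∘L fstH1)
  refine exists_continuousLinearMap_of_tendsto (l := 𝓝[>] (0 : ℝ)) (g := A) fun f => ?_
  have hd : HasDerivAt (fun y => ∫ z in x..y, f.rep z) (f.rep x) x :=
    (f.continuous_rep.integral_hasStrictDerivAt x x).hasDerivAt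
  refine hd.tendsto_slope_zero_right.congr' ?_
  filter_upwards [self_mem_nhdsWithin] with h hh
  have hh0 : 0 < h := hh
  have e : A h f = h⁻¹ • inner ℝ (indicatorConstLp 2 (measurableSet_Ioc (a := x) (b := x + h))
    (by simp) (1 : ℝ)) f.1.fst := rfl
  rw [e, L2.inner_indicatorConstLp_one, intervalIntegral.integral_same, sub_zero,
    intervalIntegral.integral_of_le (by linarith)]
  congr 1
  exact integral_congr_ae (ae_restrict_of_ae f.coeFn_ae_eq_rep.symm)

theorem rep_heatKernelH1 (s : ℝ) : (heatKernelH1 s).rep = heatKernel s :=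
  H1.rep_eq_of_ae_eq (continuous_heatKernel s)
    ((heatKernelH1 s).coeFn_ae_eq_rep.symm.trans (memLp_heatKernel s).coeFn_toLp)

/-- A mild solution satisfies the variation of constants formula pointwise. -/
theorem IsMildSolution.rep_apply {D R a : ℝ} {Φ : ℝ → ℝ} {u₀ : H1} {u : ℝ → H1} (hD : 0 < D)
    (hu : IsMildSolution D R a Φ u₀ u) {t : ℝ} (ht : 0 < t) (x : ℝ) :
    (u t).rep x = heatFlow (D * t) u₀.rep x +
      ∫ τ in (0 : ℝ)..t, feedback R a Φ τ (u τ) * heatKernel (D * (t - τ)) x := by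
  rw [H1.rep_eq_of_ae_eq ((continuous_heatFlow (mul_pos hD ht) u₀.memLp_rep).add
    (H1.continuous_rep _)) (hu.variation_of_constants t ht)]
  obtain ⟨L, hL⟩ := H1.exists_evaluation x
  rw [Pi.add_apply, ← hL, ← L.intervalIntegral_comp_comm (hu.integrable t ht)]
  have hsmul : ∀ (c : ℝ) (f : H1), L (c • f) = c * f.rep x := fun c f => by
    rw [map_smul, hL, smul_eq_mul]
  simp only [hsmul, rep_heatKernelH1]

theorem IsLocallyBounded.integrable {Φ : ℝ → ℝ} (hΦ : IsLocallyBounded Φ) (t : ℝ) :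
    Integrable Φ (volume.restrict (Ioc 0 t)) :=
  ((hΦ t).integrable le_top).mono_measure (Measure.restrict_mono_set _ Ioc_subset_Icc_self)

theorem proposition2p4
    (D R a : ℝ) (hD : 0 < D) (hR : 0 < R)
    (ha : a * R / D ∈ Set.Ioc 0 (Real.exp (-1)))
    (Φ : ℝ → ℝ) (hΦ : IsLocallyBounded Φ) (hΦexp : IsExponentialOrder Φ)
    (hΦ0 : ∀ᵐ t ∂(MeasureTheory.volume.restrict (Set.Ici (0 : ℝ))), 0 ≤ Φ t)
    (u₀ : H1) (hu₀ : ∀ x, 0 ≤ u₀.rep x)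
    (hsymm : ∀ x ∉ Set.Ioo (-(R / 2)) (R / 2), u₀.rep (-x) = u₀.rep x)
    (u : ℝ → H1) (hu : IsMildSolution D R a Φ u₀ u) :
    ∀ t, 0 ≤ t → ∀ x ∉ Set.Ioo (-R) R, 0 ≤ (u t).rep x := by
  have hpos : ∀ t, 0 < t → ∀ x, R < |x| → 0 ≤ (u t).rep x := by
    intro t ht x hx
    have hcont : ∀ z, ContinuousOn (fun s => (u s).rep z) (Icc 0 t) := fun z => by
      obtain ⟨L, hL⟩ := H1.exists_evaluation z
      simp only [← hL]
      exact (L.continuous.comp_continuousOn hu.continuousOn).mono Icc_subset_Ici_self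
    have hci : ∀ z, Integrable (fun s => (u s).rep z) (volume.restrict (Ioc 0 t)) := fun z =>
      ((hcont z).integrableOn_Icc).mono_set Ioc_subset_Icc_self
    have hΦi := hΦ.integrable t
    have hΦ0' : ∀ᵐ s ∂(volume.restrict (Ioc 0 t)), 0 ≤ Φ s :=
      ae_mono (Measure.restrict_mono_set _ fun s hs => hs.1.le) hΦ0
    have hval : ∀ s ∈ Ioc 0 t, ∀ z, (u s).rep z = heatFlow (D * s) u₀.rep z +
        ∫ r in (0 : ℝ)..s, feedback R a Φ r (u r) * heatKernel (D * (s - r)) z :=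
      fun s hs => hu.rep_apply hD hs.1
    rcases le_total 0 x with h0 | h0
    · rw [abs_of_nonneg h0] at hx
      rw [hval t ⟨ht, le_rfl⟩ x]
      have hfb : ∀ r, feedback R a Φ r (u r) = Φ r - a * ((u r).rep R + (u r).rep (-R)) :=
        fun r => by rw [feedback, add_comm]
      simp only [hfb] at hval ⊢
      have := heatFlow_add_duhamel_nonneg hD hR ht ha hΦi hΦ0' u₀.continuous_rep u₀.memLp_rep hu₀
        hsymm (U := fun s => (u s).rep R) (U' := fun s => (u s).rep (-R))
        (hΦi.sub (((hci R).add (hci (-R))).const_mul a)) (fun s hs => hval s hs R)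
        (fun s hs => by simpa only [heatKernel_neg] using hval s hs (-R)) (sub_pos.2 hx)
      simpa only [sub_add_cancel] using this
    -- Left of `-R`, the same result is applied to the reflected data, with the roles of the two
    -- sensor values exchanged.
    · rw [abs_of_nonpos h0] at hx
      rw [hval t ⟨ht, le_rfl⟩ x]
      simp only [feedback] at hval ⊢
      have := heatFlow_add_duhamel_nonneg hD hR ht ha hΦi hΦ0' (f := fun y => u₀.rep (-y))
        (u₀.continuous_rep.comp continuous_neg)
        (u₀.memLp_rep.comp_measurePreserving (Measure.measurePreserving_neg volume))
        (fun y => hu₀ (-y)) (fun y hy => by rw [neg_neg]; exact (hsymm y hy).symm)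
        (U := fun s => (u s).rep (-R)) (U' := fun s => (u s).rep R)
        (hΦi.sub (((hci (-R)).add (hci R)).const_mul a))
        (fun s hs => by
          simpa only [heatKernel_neg, heatFlow_comp_neg] using hval s hs (-R))
        (fun s hs => by
          simpa only [heatFlow_comp_neg, neg_neg] using hval s hs R) (sub_pos.2 hx)
      simpa only [sub_add_cancel, heatFlow_comp_neg, neg_neg, heatKernel_neg] using this
  intro t ht x hx
  rcases ht.eq_or_lt with rfl | ht
  · rw [hu.initial]; exact hu₀ x
  have hxR : R ≤ |x| := by
    by_contra hlt
    exact hx (abs_lt.1 (not_le.1 hlt))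
  -- The half-line argument needs positive distance from the sensor; the points `±R` are reached by
  -- continuity.
  have hcl : x ∈ closure {y : ℝ | R < |y|} := by
    have hx0 : 0 < |x| := hR.trans_le hxR
    refine mem_closure_of_tendsto (f := fun n : ℕ => x * (1 + 1 / ((n : ℝ) + 1)))
      (b := atTop) ?_ (Eventually.of_forall fun n => ?_)
    · simpa using (tendsto_one_div_add_atTop_nhds_zero_nat (𝕜 := ℝ)).const_add 1 |>.const_mul x
    · have hn : (0 : ℝ) < 1 / ((n : ℝ) + 1) := by positivity
      have hm : 0 < |x| * (1 / ((n : ℝ) + 1)) := mul_pos hx0 hn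
      rw [mem_ofPred_eq, abs_mul, abs_of_pos (by positivity : (0 : ℝ) < 1 + 1 / ((n : ℝ) + 1))]
      linarith
  exact closure_minimal (fun y hy => hpos t ht y hy)
    (isClosed_Ici.preimage (u t).continuous_rep) hcl
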